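/- Let $\Omega\subset\mathbb R^{n}$ be a (smooth) bounded domain, let $H=L^2(\Omega)$ with norm $\|\cdot\|$, let $r>0$, and let $C=C([-r,0];H)$ with the norm $\|\varphi\|_C=\max_{\theta\in[-r,0]}\|\varphi(\theta)\|$. Let $A:D(A)\subset H\to H$ be a densely defined self-adjoint positive operator ($\langle Ax,x\rangle>0$ for $0\ne x\in D(A)$) with compact resolvent, and let $d\ge 0$. Let $B:H\to H$ be Lipschitz continuous and bounded, i.e. $\sup_{v\in H}\|B(v)\|<\infty$. Let $\eta,\Theta^u,\Theta^\ell:C\to[0,r]$ be continuous with $\Theta^\ell(\varphi)\le\Theta^u(\varphi)$ for all $\varphi\in C$, and assume that $\eta$ ignores the values of $\varphi$ outside $[-\Theta^u(\varphi),-\Theta^\ell(\varphi)]$: for all $\varphi,\psi\in C$, if $\psi(\theta)=\varphi(\theta)$ for every $\theta\in[-\Theta^u(\varphi),-\Theta^\ell(\varphi)]$, then $\eta(\psi)=\eta(\varphi)$. Assume moreover that one of the following two sets of conditions holds. (I) $\Theta^\ell(\varphi)>0$ for all $\varphi\in C$. (II) With $Z=\{\varphi\in C:\Theta^\ell(\varphi)=0\}$: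 there is $L$ such that $\|\varphi(t)-\varphi(s)\|\le L|t-s|$ for all $\varphi\in Z$ and $s,t\in[-r,0]$; $\eta(\varphi)>0$ for all $\varphi\in Z$; and there are $\omega>0$ and $L_\eta>0$ such that $|\eta(\varphi)-\eta(\psi)|\le L_\eta\|\varphi-\psi\|_C$ for all $\varphi,\psi\in U_\omega(Z)=\{\chi\in C:\exists\,\nu\in Z,\ \|\chi-\nu\|_C\le\omega\}$. For $\varphi\in C$ and $T\ge 0$, a mild solution on $[-r,T]$ of $u'(t)+Au(t)+du(t)=F(u_t)$, $u|_{[-r,0]}=\varphi$, where $u_t(\theta)=u(t+\theta)$ and $F(\psi)=B(\psi(-\eta(\psi)))$, is a function $u\in C([-r,T];H)$ with $u|_{[-r,0]}=\varphi$ and $$u(t)=e^{-At}\varphi(0)+\int_0^t e^{-A(t-s)}\{F(u_s)-d\,u(s)\}\,ds,\qquad t\in[0,T].$$ Then for every $\varphi\in C$ and every $T\ge0$ there is a unique mild solution on $[-r,T]$, and the operators $S_t\varphi=u_t$ ($t\ge0$) form a dynamical system on $C$: $S_0=\mathrm{Id}$; $S_tS_\tau=S_{t+\tau}$; $t\mapsto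 S_t\varphi$ is continuous for each $\varphi\in C$; and each $S_t:C\to C$ is continuous. Moreover, $(S_t,C)$ has a compact global attractor $\mathcal A$, i.e. a nonempty compact set $\mathcal A\subset C$ with $S_t\mathcal A=\mathcal A$ for all $t\ge0$ such that $\sup_{\varphi\in D}\operatorname{dist}_C(S_t\varphi,\mathcal A)\to0$ as $t\to\infty$ for every nonempty bounded $D\subset C$; and for every $\delta\in[0,\tfrac12)$ the set $\mathcal A$ is contained in $C([-r,0];D(A^\delta))$ and is compact in that space, where $D(A^\delta)$ carries the graph norm of the fractional power $A^\delta$. -/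

import Mathlib

open Set MeasureTheory Filter Topology
open scoped NNReal

namespace DelayParabolic

noncomputable section

section Operator

variable {H : Type*} [NormedAddCommGroup H] [InnerProductSpace ℝ H] [CompleteSpace H]

/-- An unbounded operator `A` is positive: `⟪A x, x⟫ > 0` for every nonzero `x` of its domain. -/
def IsPositiveOp (A : H →ₗ.[ℝ] H) : Prop :=
  ∀ x : A.domain, x ≠ 0 → 0 < inner ℝ (A x) (x : H)

/-- `A` has compact resolvent: for some real `μ`, the map `A - μ : D(A) → H` is a bijection
whose inverse `R` is a compact (everywhere defined) operator on `H`. -/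
def HasCompactResolvent (A : H →ₗ.[ℝ] H) : Prop :=
  ∃ (μ : ℝ) (R : H →L[ℝ] H), IsCompactOperator R ∧
    (∀ y : H, ∃ hy : R y ∈ A.domain, A ⟨R y, hy⟩ - μ • R y = y) ∧
    (∀ x : A.domain, R (A x - μ • (x : H)) = x)

/-- The eigenspace `{x ∈ D(A) | A x = μ x}`. -/
def eigenspace (A : H →ₗ.[ℝ] H) (μ : ℝ) : Submodule ℝ H where
  carrier := {x | ∃ hx : x ∈ A.domain, A ⟨x, hx⟩ = μ • x}
  zero_mem' := ⟨A.domain.zero_mem, (A.map_zero).trans (smul_zero μ).symm⟩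
  add_mem' := by
    rintro x y ⟨hx, hx'⟩ ⟨hy, hy'⟩
    refine ⟨A.domain.add_mem hx hy, ?_⟩
    have h := A.map_add ⟨x, hx⟩ ⟨y, hy⟩
    rw [hx', hy', ← smul_add] at h
    exact h
  smul_mem' := by
    rintro c x ⟨hx, hx'⟩
    refine ⟨A.domain.smul_mem c hx, ?_⟩
    have h := A.map_smul c ⟨x, hx⟩
    rw [hx', smul_comm] at h
    exact h

/-- The spectral projection `P_μ` of `A`: the orthogonal projection onto the eigenspace of `μ`
(which is a closed subspace when `A` is a closed operator, e.g. when it is self-adjoint);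
`P_μ = 0` when `μ` is not an eigenvalue. -/
def specProj (A : H →ₗ.[ℝ] H) (μ : ℝ) : H →L[ℝ] H :=
  (eigenspace A μ).topologicalClosure.starProjection

/-- Functional calculus for a self-adjoint operator with compact resolvent (such an operator has
pure point spectrum): `f(A) x = ∑ f(μ) P_μ x`, with domain the set of those `x` for which the
orthogonal series converges, i.e. `∑ f(μ)² ‖P_μ x‖² < ∞`. The sum is over all real `μ`, and only
eigenvalues contribute. -/
def funCalc (A : H →ₗ.[ℝ] H) (f : ℝ → ℝ) : H →ₗ.[ℝ] H where
  domain :=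
    { carrier := {x | Summable fun μ : ℝ => f μ • specProj A μ x}
      zero_mem' := by simp [summable_zero]
      add_mem' := by
        intro x y hx hy
        have h := Summable.add hx hy
        simpa [smul_add] using h
      smul_mem' := by
        intro c x hx
        have h := Summable.const_smul c hx
        simpa [smul_comm c] using h }
  toFun :=
    { toFun := fun x => ∑' μ : ℝ, f μ • specProj A μ (x : H)
      map_add' := by
        intro x y
        have h := Summable.tsum_add x.2 y.2
        simpa [smul_add] using h
      map_smul' := by
        intro c x
        have h := Summable.tsum_const_smul c x.2
        simpa [smul_comm c] using h }

/-- The fractional power `A^δ` with its domain `D(A^δ)`. -/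
def fracPow (A : H →ₗ.[ℝ] H) (δ : ℝ) : H →ₗ.[ℝ] H :=
  funCalc A (fun μ => μ ^ δ)

/-- The semigroup operator `e^{-A t}`, used for `t ≥ 0` (for which the series converges for every
`x` when `A` is positive). -/
def semigroup (A : H →ₗ.[ℝ] H) (t : ℝ) (x : H) : H :=
  ∑' μ : ℝ, Real.exp (-(μ * t)) • specProj A μ x

end Operator

section History

variable {H : Type*} [NormedAddCommGroup H] [InnerProductSpace ℝ H]

/-- `C([-r, 0]; E)` with the supremum norm. -/
abbrev Hist (r : ℝ≥0) (E : Type*) [TopologicalSpace E] := C(Icc (-(r : ℝ)) 0, E)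

/-- The segment `u_t(θ) = u(t + θ)`, `θ ∈ [-r, 0]`. -/
def segment (r : ℝ≥0) (u : C(ℝ, H)) (t : ℝ) : Hist r H :=
  ⟨fun θ => u (t + (θ : ℝ)), by fun_prop⟩

/-- For `s ∈ [0, r]`, the point `-s ∈ [-r, 0]`. -/
def negPt {r : ℝ≥0} (s : Icc (0 : ℝ) r) : Icc (-(r : ℝ)) 0 :=
  ⟨-(s : ℝ), neg_le_neg s.2.2, neg_nonpos.mpr s.2.1⟩

/-- The delay term `F(φ) = B(φ(-η(φ)))`. -/
def delayTerm {r : ℝ≥0} (B : H → H) (η : Hist r H → Icc (0 : ℝ) r) (φ : Hist r H) : H :=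
  B (φ (negPt (η φ)))

theorem neg_le_coe (r T : ℝ≥0) : -(r : ℝ) ≤ (T : ℝ) :=
  (neg_nonpos.mpr r.2).trans T.2

/-- A function on `[-r, T]`, extended to a continuous function on `ℝ` by constants. The extension
only serves to write `u(t)` and `u_t` for a real number `t`; only values at points of `[-r, T]`
are used below. -/
def ext {r T : ℝ≥0} (u : C(Icc (-(r : ℝ)) (T : ℝ), H)) : C(ℝ, H) :=
  u.IccExtend (neg_le_coe r T)

/-- `u ∈ C([-r, T]; H)` is a mild solution on `[-r, T]` of `u' + A u + d u = B(u(t - η(u_t)))`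
with the initial function `φ`. -/
def IsMildSolution [CompleteSpace H] {r : ℝ≥0} (A : H →ₗ.[ℝ] H) (d : ℝ) (B : H → H)
    (η : Hist r H → Icc (0 : ℝ) r) (φ : Hist r H) (T : ℝ≥0)
    (u : C(Icc (-(r : ℝ)) (T : ℝ), H)) : Prop :=
  (∀ θ : Icc (-(r : ℝ)) 0, ext u (θ : ℝ) = φ θ) ∧
  ∀ t ∈ Icc (0 : ℝ) T,
    ext u t = semigroup A t (φ ⟨0, neg_nonpos.mpr r.2, le_rfl⟩) +
      ∫ s in (0 : ℝ)..t,
        semigroup A (t - s) (delayTerm B η (segment r (ext u) s) - d • ext u s)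

/-- `η` ignores the values of `φ(θ)` for `θ ∉ [-Θᵘ(φ), -Θˡ(φ)]`. -/
def IgnoresOutside {r : ℝ≥0} (η Θu Θl : Hist r H → Icc (0 : ℝ) r) : Prop :=
  ∀ φ ψ : Hist r H,
    (∀ θ : Icc (-(r : ℝ)) 0, -(Θu φ : ℝ) ≤ (θ : ℝ) → (θ : ℝ) ≤ -(Θl φ : ℝ) → ψ θ = φ θ) →
      η ψ = η φ

/-- The set `Z = {φ | Θˡ(φ) = 0}`. -/
def zeroSet {r : ℝ≥0} (Θl : Hist r H → Icc (0 : ℝ) r) : Set (Hist r H) :=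
  {φ | (Θl φ : ℝ) = 0}

/-- The set of functions with Lipschitz constant `L`. -/
def lipSet (r : ℝ≥0) (H : Type*) [NormedAddCommGroup H] (L : ℝ) : Set (Hist r H) :=
  {φ | ∀ s t : Icc (-(r : ℝ)) 0, ‖φ t - φ s‖ ≤ L * |(t : ℝ) - (s : ℝ)|}

/-- The set `U_ω(Z)` of functions at distance at most `ω` from some point of `Z`. -/
def nbhd {r : ℝ≥0} (Z : Set (Hist r H)) (ω : ℝ) : Set (Hist r H) :=
  {χ | ∃ ν ∈ Z, ‖χ - ν‖ ≤ ω}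

/-- The conditions on the zero set `Z` of `Θˡ`: its elements are Lipschitz with one common
constant, `η` is positive on `Z`, and `η` is Lipschitz on some neighbourhood `U_ω(Z)`. -/
def ZeroSetConditions {r : ℝ≥0} (η Θl : Hist r H → Icc (0 : ℝ) r) : Prop :=
  (∃ L : ℝ, zeroSet Θl ⊆ lipSet r H L) ∧
  (∀ φ ∈ zeroSet Θl, 0 < (η φ : ℝ)) ∧
  ∃ ω > (0 : ℝ), ∃ Lη > (0 : ℝ), ∀ φ ∈ nbhd (zeroSet Θl) ω, ∀ ψ ∈ nbhd (zeroSet Θl) ω,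
    |(η φ : ℝ) - (η ψ : ℝ)| ≤ Lη * ‖φ - ψ‖

/-- The space `C_δ = C([-r, 0]; D(A^δ))`, where `D(A^δ)` carries the graph norm: it is identified
with the graph of `A^δ`, a subspace of `H × H`. -/
abbrev HistPow [CompleteSpace H] (r : ℝ≥0) (A : H →ₗ.[ℝ] H) (δ : ℝ) :=
  Hist r (fracPow A δ).graph

/-- The inclusion `C([-r, 0]; D(A^δ)) → C([-r, 0]; H)`. -/
def inclPow [CompleteSpace H] {r : ℝ≥0} (A : H →ₗ.[ℝ] H) (δ : ℝ) (φ : HistPow r A δ) :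
    Hist r H :=
  ⟨fun θ => (φ θ : H × H).1, by fun_prop⟩

end History

/-- `(S_t, X)`, `t ≥ 0`, is a dynamical system. -/
structure IsDynamicalSystem {X : Type*} [TopologicalSpace X] (S : ℝ≥0 → X → X) : Prop where
  zero : ∀ x, S 0 x = x
  add : ∀ t τ x, S t (S τ x) = S (t + τ) x
  strongly_continuous : ∀ x, Continuous fun t => S t x
  continuous : ∀ t, Continuous (S t)

/-- `𝒜` is a compact global attractor of `(S_t, X)`: a nonempty compact set that is invariant,
`S_t 𝒜 = 𝒜`, and attracts every bounded set `D`: `sup_{x ∈ D} dist (S_t x, 𝒜) → 0` as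
`t → ∞`. -/
structure IsCompactGlobalAttractor {X : Type*} [PseudoMetricSpace X] (S : ℝ≥0 → X → X)
    (𝒜 : Set X) : Prop where
  nonempty : 𝒜.Nonempty
  compact : IsCompact 𝒜
  invariant : ∀ t, S t '' 𝒜 = 𝒜
  attracts : ∀ D : Set X, Bornology.IsBounded D → ∀ ε > (0 : ℝ), ∃ t₀ : ℝ≥0, ∀ t ≥ t₀,
    ∀ x ∈ D, ∃ y ∈ 𝒜, dist (S t x) y < ε

end

end DelayParabolic

namespace DelayParabolic

section SpectralFamily

variable {H : Type*} [NormedAddCommGroup H] [InnerProductSpace ℝ H]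

/-- A family of mutually orthogonal projections with sum the identity. -/
structure SpectralFamily (P : ℝ → H →L[ℝ] H) : Prop where
  idem : ∀ μ x, P μ (P μ x) = P μ x
  ortho : ∀ μ ν, μ ≠ ν → ∀ x, P μ (P ν x) = 0
  symm : ∀ μ x y, inner ℝ (P μ x) y = inner ℝ x (P μ y)
  hasSum : ∀ x, HasSum (fun μ => P μ x) x

namespace SpectralFamily

variable {P : ℝ → H →L[ℝ] H}

theorem inner_self_apply (hP : SpectralFamily P) (μ : ℝ) (x : H) :
    inner ℝ x (P μ x) = ‖P μ x‖ ^ 2 := by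
  rw [← real_inner_self_eq_norm_sq, hP.symm, hP.idem]

theorem hasSum_norm_sq (hP : SpectralFamily P) (x : H) :
    HasSum (fun μ => ‖P μ x‖ ^ 2) (‖x‖ ^ 2) := by
  have h := (hP.hasSum x).mapL (innerSL ℝ x)
  simpa only [innerSL_apply_apply, real_inner_self_eq_norm_sq, hP.inner_self_apply] using h

theorem sum_norm_sq_le (hP : SpectralFamily P) (F : Finset ℝ) (x : H) :
    ∑ μ ∈ F, ‖P μ x‖ ^ 2 ≤ ‖x‖ ^ 2 :=
  sum_le_hasSum F (fun _ _ => sq_nonneg _) (hP.hasSum_norm_sq x)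

theorem eq_of_forall (hP : SpectralFamily P) {x y : H} (h : ∀ μ, P μ x = P μ y) : x = y :=
  (hP.hasSum x).unique (by simpa only [h] using hP.hasSum y)

theorem apply_apply (hP : SpectralFamily P) (μ ν : ℝ) (x : H) :
    P ν (P μ x) = if μ = ν then P ν x else 0 := by
  split_ifs with h
  · rw [h, hP.idem]
  · exact hP.ortho _ _ (Ne.symm h) _

theorem apply_of_hasSum (hP : SpectralFamily P) {g : ℝ → ℝ} {x y : H}
    (h : HasSum (fun μ => g μ • P μ x) y) (ν : ℝ) : P ν y = g ν • P ν x := by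
  have h1 := h.mapL (P ν)
  refine h1.unique ?_
  have h2 : (fun μ => P ν (g μ • P μ x)) = fun μ => if μ = ν then g ν • P ν x else 0 := by
    funext μ
    rw [map_smul, hP.apply_apply]
    split_ifs with h3
    · rw [h3]
    · rw [smul_zero]
  rw [h2]
  exact hasSum_ite_eq ν _

theorem hasSum_norm_sq_of_hasSum (hP : SpectralFamily P) {g : ℝ → ℝ} {x y : H}
    (h : HasSum (fun μ => g μ • P μ x) y) :
    HasSum (fun μ => g μ ^ 2 * ‖P μ x‖ ^ 2) (‖y‖ ^ 2) := by
  have h1 := hP.hasSum_norm_sq y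
  simpa only [hP.apply_of_hasSum h, norm_smul, mul_pow, Real.norm_eq_abs, sq_abs] using h1

theorem orthogonalFamily (hP : SpectralFamily P) :
    OrthogonalFamily ℝ (fun μ => LinearMap.range (P μ).toLinearMap)
      fun μ => (LinearMap.range (P μ).toLinearMap).subtypeₗᵢ := by
  rintro μ ν h ⟨_, x, rfl⟩ ⟨_, y, rfl⟩
  change inner ℝ (P μ x) (P ν y) = 0
  rw [hP.symm, hP.ortho _ _ h, inner_zero_right]

theorem norm_sq_sum (hP : SpectralFamily P) (g : ℝ → ℝ) (F : Finset ℝ) (x : H) :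
    ‖∑ μ ∈ F, g μ • P μ x‖ ^ 2 = ∑ μ ∈ F, g μ ^ 2 * ‖P μ x‖ ^ 2 := by
  have h := hP.orthogonalFamily.norm_sum
    (fun μ => ⟨g μ • P μ x, g μ • x, by simp⟩) F
  simpa [norm_smul, mul_pow] using h

theorem summable_iff [CompleteSpace H] (hP : SpectralFamily P) {g : ℝ → ℝ} {x : H} :
    Summable (fun μ => g μ • P μ x) ↔ Summable fun μ => g μ ^ 2 * ‖P μ x‖ ^ 2 := by
  have h := hP.orthogonalFamily.summable_iff_norm_sq_summable
    (fun μ => ⟨g μ • P μ x, g μ • x, by simp⟩)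
  simpa [norm_smul, mul_pow] using h

theorem mul_norm_sq_le {g : ℝ → ℝ} {c : ℝ} (hg : ∀ μ, P μ ≠ 0 → |g μ| ≤ c) (μ : ℝ) (x : H) :
    g μ ^ 2 * ‖P μ x‖ ^ 2 ≤ c ^ 2 * ‖P μ x‖ ^ 2 := by
  by_cases h : P μ = 0
  · simp [h]
  · gcongr ?_ * _
    exact sq_le_sq' (by linarith [neg_le_of_abs_le (hg μ h)]) (le_of_abs_le (hg μ h))

theorem summable_of_bounded [CompleteSpace H] (hP : SpectralFamily P) {g : ℝ → ℝ} {c : ℝ}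
    (hg : ∀ μ, P μ ≠ 0 → |g μ| ≤ c) (x : H) : Summable fun μ => g μ • P μ x :=
  hP.summable_iff.2 <| Summable.of_nonneg_of_le (fun _ => by positivity)
    (fun μ => mul_norm_sq_le hg μ x) ((hP.hasSum_norm_sq x).summable.mul_left _)

theorem norm_le_of_hasSum (hP : SpectralFamily P) {g : ℝ → ℝ} {c : ℝ} (hc : 0 ≤ c)
    (hg : ∀ μ, P μ ≠ 0 → |g μ| ≤ c) {x y : H} (h : HasSum (fun μ => g μ • P μ x) y) :
    ‖y‖ ≤ c * ‖x‖ := by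
  refine le_of_sq_le_sq ?_ (by positivity)
  rw [mul_pow]
  exact hasSum_le (fun μ => mul_norm_sq_le hg μ x) (hP.hasSum_norm_sq_of_hasSum h)
    ((hP.hasSum_norm_sq x).mul_left _)

/-- The bounded operator `∑ g(μ) P_μ` for a function `g` with `|g| ≤ 1` on the spectrum
(and zero for other functions). -/
noncomputable def diag [CompleteSpace H] (hP : SpectralFamily P) (g : ℝ → ℝ) : H →L[ℝ] H :=
  open Classical in
  if hg : ∀ μ, P μ ≠ 0 → |g μ| ≤ 1 then
    LinearMap.mkContinuous
      { toFun := fun x => ∑' μ, g μ • P μ x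
        map_add' := fun x y => by
          rw [← Summable.tsum_add (hP.summable_of_bounded hg x) (hP.summable_of_bounded hg y)]
          simp
        map_smul' := fun a x => by
          rw [RingHom.id_apply, ← Summable.tsum_const_smul a (hP.summable_of_bounded hg x)]
          simp [smul_comm a] } 1
      fun x => hP.norm_le_of_hasSum zero_le_one hg (hP.summable_of_bounded hg x).hasSum
  else 0

theorem diag_apply [CompleteSpace H] (hP : SpectralFamily P) {g : ℝ → ℝ}
    (hg : ∀ μ, P μ ≠ 0 → |g μ| ≤ 1) (x : H) : hP.diag g x = ∑' μ, g μ • P μ x := by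
  rw [diag, dif_pos hg]
  rfl

theorem hasSum_diag [CompleteSpace H] (hP : SpectralFamily P) {g : ℝ → ℝ}
    (hg : ∀ μ, P μ ≠ 0 → |g μ| ≤ 1) (x : H) :
    HasSum (fun μ => g μ • P μ x) (hP.diag g x) := by
  rw [hP.diag_apply hg]
  exact (hP.summable_of_bounded hg x).hasSum

theorem apply_diag [CompleteSpace H] (hP : SpectralFamily P) {g : ℝ → ℝ}
    (hg : ∀ μ, P μ ≠ 0 → |g μ| ≤ 1) (x : H) (ν : ℝ) : P ν (hP.diag g x) = g ν • P ν x :=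
  hP.apply_of_hasSum (hP.hasSum_diag hg x) ν

end SpectralFamily

end SpectralFamily

section Resolvent

variable {H : Type*} [NormedAddCommGroup H] [InnerProductSpace ℝ H]

/-- `R = (A - μ)⁻¹`. -/
def IsResolventAt (A : H →ₗ.[ℝ] H) (μ : ℝ) (R : H →L[ℝ] H) : Prop :=
  (∀ y : H, ∃ hy : R y ∈ A.domain, A ⟨R y, hy⟩ - μ • R y = y) ∧
    (∀ x : A.domain, R (A x - μ • (x : H)) = x)

variable {A : H →ₗ.[ℝ] H} {μ₀ : ℝ} {R : H →L[ℝ] H}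

theorem IsResolventAt.mem_eigenspace_iff (hR : IsResolventAt A μ₀ R) {μ : ℝ} {x : H} :
    x ∈ eigenspace A μ ↔ x = (μ - μ₀) • R x := by
  constructor
  · rintro ⟨hx, h⟩
    have h1 := hR.2 ⟨x, hx⟩
    rw [h, ← sub_smul, map_smul] at h1
    exact h1.symm
  · intro h
    obtain ⟨hy, hy'⟩ := hR.1 x
    have hx : x ∈ A.domain := by
      rw [h]
      exact A.domain.smul_mem _ hy
    refine ⟨hx, ?_⟩
    have h2 : (⟨x, hx⟩ : A.domain) = (μ - μ₀) • ⟨R x, hy⟩ := Subtype.ext h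
    rw [h2, A.map_smul, eq_add_of_sub_eq hy', smul_add, smul_comm, ← h, ← add_smul]
    congr 1
    ring

theorem IsResolventAt.isClosed_eigenspace (hR : IsResolventAt A μ₀ R) (μ : ℝ) :
    IsClosed (eigenspace A μ : Set H) := by
  have h : (eigenspace A μ : Set H) = {x | x = (μ - μ₀) • R x} := by
    ext x
    exact hR.mem_eigenspace_iff
  rw [h]
  exact isClosed_eq continuous_id (by fun_prop)

variable [CompleteSpace H]

theorem inner_apply_comm (hA : Dense (A.domain : Set H)) (hsa : IsSelfAdjoint A)
    (x y : A.domain) : inner ℝ (A x) (y : H) = inner ℝ (x : H) (A y) := by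
  have h := LinearPMap.adjoint_isFormalAdjoint hA
  rw [LinearPMap.isSelfAdjoint_def.1 hsa] at h
  exact h x y

theorem IsResolventAt.isSymmetric (hR : IsResolventAt A μ₀ R) (hA : Dense (A.domain : Set H))
    (hsa : IsSelfAdjoint A) : (R : H →ₗ[ℝ] H).IsSymmetric := by
  intro x y
  obtain ⟨hx, hx'⟩ := hR.1 x
  obtain ⟨hy, hy'⟩ := hR.1 y
  have h := inner_apply_comm hA hsa ⟨R x, hx⟩ ⟨R y, hy⟩
  change inner ℝ (R x) y = inner ℝ x (R y)
  calc inner ℝ (R x) y = inner ℝ (R x) (A ⟨R y, hy⟩ - μ₀ • R y) := by rw [hy']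
    _ = inner ℝ (A ⟨R x, hx⟩ - μ₀ • R x) (R y) := by
      rw [inner_sub_left, inner_sub_right, real_inner_smul_left, real_inner_smul_right]
      exact congrArg (· - _) h.symm
    _ = inner ℝ x (R y) := by rw [hx']

theorem inner_eq_zero_of_mem_eigenspace (hA : Dense (A.domain : Set H)) (hsa : IsSelfAdjoint A)
    {μ ν : ℝ} (h : μ ≠ ν) {x y : H} (hx : x ∈ eigenspace A μ) (hy : y ∈ eigenspace A ν) :
    inner ℝ x y = 0 := by
  obtain ⟨hx, hx'⟩ := hx
  obtain ⟨hy, hy'⟩ := hy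
  have h1 := inner_apply_comm hA hsa ⟨x, hx⟩ ⟨y, hy⟩
  rw [hx', hy', real_inner_smul_left, real_inner_smul_right] at h1
  have h2 : (μ - ν) * inner ℝ x y = 0 := by linear_combination h1
  exact (mul_eq_zero.1 h2).resolve_left (sub_ne_zero.2 h)

theorem IsResolventAt.specProj_mem (hR : IsResolventAt A μ₀ R) (μ : ℝ) (x : H) :
    specProj A μ x ∈ eigenspace A μ := by
  have h : specProj A μ x ∈ (eigenspace A μ).topologicalClosure :=
    Submodule.starProjection_apply_mem _ x
  rwa [(hR.isClosed_eigenspace μ).submodule_topologicalClosure_eq] at h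

theorem specProj_of_mem {μ : ℝ} {x : H} (hx : x ∈ eigenspace A μ) : specProj A μ x = x :=
  Submodule.starProjection_eq_self_iff.2 (Submodule.le_topologicalClosure _ hx)

theorem specProj_symm (μ : ℝ) (x y : H) :
    inner ℝ (specProj A μ x) y = inner ℝ x (specProj A μ y) :=
  Submodule.inner_starProjection_left_eq_right _ _ _

theorem IsResolventAt.iSup_eigenspace (hR : IsResolventAt A μ₀ R) (hc : IsCompactOperator R)
    (hA : Dense (A.domain : Set H)) (hsa : IsSelfAdjoint A) :
    (⨆ μ, eigenspace A μ).topologicalClosure = ⊤ := by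
  have h : (⨆ ν, Module.End.eigenspace (R : Module.End ℝ H) ν)ᗮ = ⊥ :=
    ContinuousLinearMap.orthogonalComplement_iSup_eigenspaces_eq_bot hc
      (hR.isSymmetric hA hsa)
  have hle : (⨆ ν, Module.End.eigenspace (R : Module.End ℝ H) ν) ≤ ⨆ μ, eigenspace A μ := by
    refine iSup_le fun ν x hx => ?_
    have hx' : R x = ν • x := Module.End.mem_eigenspace_iff.1 hx
    by_cases hν : ν = 0
    · obtain ⟨hy, hy'⟩ := hR.1 x
      have h0 : R x = 0 := by rw [hx', hν, zero_smul]
      have h1 : (⟨R x, hy⟩ : A.domain) = 0 := Subtype.ext h0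
      rw [h1, h0, A.map_zero, smul_zero, sub_zero] at hy'
      rw [← hy']
      exact Submodule.zero_mem _
    · refine Submodule.mem_iSup_of_mem (μ₀ + ν⁻¹) (hR.mem_eigenspace_iff.2 ?_)
      rw [hx', smul_smul, add_sub_cancel_left, inv_mul_cancel₀ hν, one_smul]
  have h2 : (⨆ μ, eigenspace A μ)ᗮ = ⊥ :=
    le_bot_iff.1 ((Submodule.orthogonal_le hle).trans h.le)
  exact (Submodule.topologicalClosure_eq_top_iff).2 h2

theorem IsResolventAt.spectralFamily (hR : IsResolventAt A μ₀ R) (hc : IsCompactOperator R)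
    (hA : Dense (A.domain : Set H)) (hsa : IsSelfAdjoint A) : SpectralFamily (specProj A) := by
  have hort : ∀ μ ν, μ ≠ ν → ∀ x, specProj A μ (specProj A ν x) = 0 := by
    intro μ ν h x
    refine ext_inner_right ℝ fun y => ?_
    rw [specProj_symm, inner_zero_left]
    exact inner_eq_zero_of_mem_eigenspace hA hsa h.symm (hR.specProj_mem ν x)
      (hR.specProj_mem μ y)
  refine ⟨fun μ x => specProj_of_mem (hR.specProj_mem μ x), hort, specProj_symm, fun x => ?_⟩
  have hcl : ∀ μ, CompleteSpace (eigenspace A μ) := fun μ =>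
    (hR.isClosed_eigenspace μ).completeSpace_coe
  have hof : OrthogonalFamily ℝ (fun μ => eigenspace A μ)
      fun μ => (eigenspace A μ).subtypeₗᵢ := fun μ ν h x y =>
    inner_eq_zero_of_mem_eigenspace hA hsa h x.2 y.2
  have hs := IsHilbertSum.mkInternal (eigenspace A) hof (hR.iSup_eigenspace hc hA hsa).ge
  have h1 := hs.hasSum_linearIsometryEquiv_symm (hs.linearIsometryEquiv x)
  rw [LinearIsometryEquiv.symm_apply_apply] at h1
  set v := hs.linearIsometryEquiv x
  have h2 : ∀ ν, specProj A ν x = v ν := by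
    intro ν
    have h3 := h1.mapL (specProj A ν)
    have h4 : (fun μ => specProj A ν ((eigenspace A μ).subtypeₗᵢ (v μ))) =
        fun μ => if μ = ν then (v ν : H) else 0 := by
      funext μ
      change specProj A ν (v μ : H) = _
      split_ifs with h
      · subst h
        exact specProj_of_mem (v μ).2
      · rw [← specProj_of_mem (v μ).2]
        exact hort _ _ (Ne.symm h) _
    rw [h4] at h3
    exact h3.unique (hasSum_ite_eq ν _)
  simp only [h2]
  exact h1

theorem IsResolventAt.apply_specProj (hR : IsResolventAt A μ₀ R) (μ : ℝ) (x : H) :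
    (μ - μ₀) • R (specProj A μ x) = specProj A μ x :=
  (hR.mem_eigenspace_iff.1 (hR.specProj_mem μ x)).symm

theorem IsResolventAt.pos_of_specProj_ne_zero (hR : IsResolventAt A μ₀ R)
    (hpos : IsPositiveOp A) {μ : ℝ} (h : specProj A μ ≠ 0) : 0 < μ := by
  obtain ⟨x, hx⟩ := DFunLike.ne_iff.1 h
  change specProj A μ x ≠ 0 at hx
  obtain ⟨hy, hy'⟩ := hR.specProj_mem μ x
  have h1 := hpos ⟨_, hy⟩ (fun h0 => hx (congrArg Subtype.val h0))
  rw [hy', real_inner_smul_left, real_inner_self_eq_norm_sq] at h1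
  exact pos_of_mul_pos_left h1 (sq_nonneg _)

/-- Bounded sets of vectors with bounded spectral support are relatively compact. -/
theorem IsResolventAt.exists_isCompact (hR : IsResolventAt A μ₀ R) (hc : IsCompactOperator R)
    (hA : Dense (A.domain : Set H)) (hsa : IsSelfAdjoint A) (hpos : IsPositiveOp A) (N ρ : ℝ) :
    ∃ K : Set H, IsCompact K ∧
      ∀ x, ‖x‖ ≤ ρ → (∀ μ, N < μ → specProj A μ x = 0) → x ∈ K := by
  have hP := hR.spectralFamily hc hA hsa
  set c : ℝ := |N| + |μ₀|
  obtain ⟨K, hK, hK'⟩ := hc.image_closedBall_subset_compact (f := (R : H →ₗ[ℝ] H)) (c * ρ)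
  refine ⟨K, hK, fun x hx hN => hK' ?_⟩
  let g : ℝ → ℝ := fun μ => if μ ≤ N then μ - μ₀ else 0
  have hg : ∀ μ, specProj A μ ≠ 0 → |g μ| ≤ c := by
    intro μ h
    have hμ := hR.pos_of_specProj_ne_zero hpos h
    simp only [g]
    split_ifs with h1
    · calc |μ - μ₀| ≤ |μ| + |μ₀| := abs_sub _ _
        _ ≤ c := by
          have : |μ| ≤ |N| := abs_le_abs h1 (by linarith)
          simp only [c]
          linarith
    · rw [abs_zero]
      positivity
  have hs := (hP.summable_of_bounded hg x).hasSum
  set y := ∑' μ, g μ • specProj A μ x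
  have hc0 : 0 ≤ c := by positivity
  have hy : ‖y‖ ≤ c * ‖x‖ := hP.norm_le_of_hasSum hc0 hg hs
  refine ⟨y, mem_closedBall_zero_iff.2 (hy.trans (by gcongr)), ?_⟩
  have h1 := hs.mapL R
  refine h1.unique ?_
  convert hP.hasSum x using 2 with μ
  simp only [g, map_smul]
  split_ifs with h2
  · exact hR.apply_specProj μ x
  · rw [hN μ (not_le.1 h2), zero_smul]

end Resolvent

section Gap

variable {H : Type*} [NormedAddCommGroup H] [InnerProductSpace ℝ H]

/-- A positive spectrum with relatively compact low-energy sets is bounded away from zero. -/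
theorem SpectralFamily.exists_pos_lower_bound {P : ℝ → H →L[ℝ] H} (hP : SpectralFamily P)
    (hpos : ∀ μ, P μ ≠ 0 → 0 < μ)
    (hK : ∀ N ρ : ℝ, ∃ K : Set H, IsCompact K ∧
      ∀ x, ‖x‖ ≤ ρ → (∀ μ, N < μ → P μ x = 0) → x ∈ K) :
    ∃ c > 0, ∀ μ, P μ ≠ 0 → c ≤ μ := by
  by_contra! hcon
  obtain ⟨K, hKc, hK⟩ := hK 1 1
  have h1 : ∀ n : ℕ, ∃ μ : ℝ, 0 < μ ∧ μ < 1 / ((n : ℝ) + 1) ∧ ∃ e : H, ‖e‖ = 1 ∧ P μ e = e := by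
    intro n
    obtain ⟨μ, hμ, hμ'⟩ := hcon (1 / ((n : ℝ) + 1)) (by positivity)
    obtain ⟨x, hx⟩ := DFunLike.ne_iff.1 hμ
    change P μ x ≠ 0 at hx
    refine ⟨μ, hpos μ hμ, hμ', ‖P μ x‖⁻¹ • P μ x, ?_, ?_⟩
    · rw [norm_smul, norm_inv, norm_norm, inv_mul_cancel₀ (norm_ne_zero_iff.2 hx)]
    · rw [map_smul, hP.idem]
  choose μ hμ0 hμ1 e he he' using h1
  have hPe : ∀ n ν, ν ≠ μ n → P ν (e n) = 0 := fun n ν h => by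
    rw [← he' n, hP.ortho _ _ h]
  have hle : ∀ n, μ n ≤ 1 := fun n => (hμ1 n).le.trans (by
    rw [div_le_one (by positivity)]
    linarith [n.cast_nonneg (α := ℝ)])
  have hmem : ∀ n, e n ∈ K := fun n => hK _ (he n).le fun ν hν =>
    hPe n ν (fun h => by linarith [hle n])
  obtain ⟨x, -, φ, hφ, hlim⟩ := hKc.tendsto_subseq hmem
  have hμlim : Tendsto (fun n => μ (φ n)) atTop (𝓝 0) :=
    (squeeze_zero (fun n => (hμ0 n).le) (fun n => (hμ1 n).le)
      tendsto_one_div_add_atTop_nhds_zero_nat).comp hφ.tendsto_atTop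
  have hx0 : x = 0 := by
    refine hP.eq_of_forall fun ν => ?_
    rw [map_zero]
    have h2 : Tendsto (fun n => P ν (e (φ n))) atTop (𝓝 (P ν x)) :=
      ((P ν).continuous.tendsto x).comp hlim
    have h3 : ∀ᶠ n in atTop, P ν (e (φ n)) = 0 := by
      rcases lt_or_ge 0 ν with h | h
      · filter_upwards [hμlim.eventually_lt_const h] with n hn using hPe _ _ hn.ne'
      · exact Eventually.of_forall fun n => hPe _ _ (h.trans_lt (hμ0 _)).ne
    exact tendsto_nhds_unique h2 (tendsto_const_nhds.congr' (h3.mono fun _ h => h.symm))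
  have h4 : ‖x‖ = 1 := tendsto_nhds_unique hlim.norm (by simp [he])
  rw [hx0, norm_zero] at h4
  exact zero_ne_one h4

end Gap

section EnergySet

variable {H : Type*} [NormedAddCommGroup H] [InnerProductSpace ℝ H]

/-- A spectral family of a positive operator with compact resolvent. -/
structure DiscreteFamily (P : ℝ → H →L[ℝ] H) : Prop extends SpectralFamily P where
  gap : ∃ c > 0, ∀ μ, P μ ≠ 0 → c ≤ μ
  compact : ∀ N ρ : ℝ, ∃ K : Set H, IsCompact K ∧
    ∀ x, ‖x‖ ≤ ρ → (∀ μ, N < μ → P μ x = 0) → x ∈ K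

/-- The set `{x | ‖(A + d)^{1/2} x‖ ≤ C}`, described through finite partial sums. -/
def energySet (P : ℝ → H →L[ℝ] H) (d C : ℝ) : Set H :=
  {x | ∀ F : Finset ℝ, ‖∑ μ ∈ F, √(μ + d) • P μ x‖ ≤ C}

variable {P : ℝ → H →L[ℝ] H} {d C : ℝ}

theorem energySet_mono {C' : ℝ} (h : C ≤ C') : energySet P d C ⊆ energySet P d C' :=
  fun _ hx F => (hx F).trans h

theorem add_mem_energySet {C' : ℝ} {x y : H} (hx : x ∈ energySet P d C)
    (hy : y ∈ energySet P d C') : x + y ∈ energySet P d (C + C') := fun F => by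
  simp only [map_add, smul_add, Finset.sum_add_distrib]
  exact (norm_add_le _ _).trans (add_le_add (hx F) (hy F))

theorem sub_mem_energySet {C' : ℝ} {x y : H} (hx : x ∈ energySet P d C)
    (hy : y ∈ energySet P d C') : x - y ∈ energySet P d (C + C') := fun F => by
  simp only [map_sub, smul_sub, Finset.sum_sub_distrib]
  exact (norm_sub_le _ _).trans (add_le_add (hx F) (hy F))

theorem isClosed_energySet : IsClosed (energySet P d C) := by
  simp only [energySet, Set.ofPred_forall]
  exact isClosed_iInter fun F => isClosed_le (by fun_prop) continuous_const

namespace DiscreteFamily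

theorem pos (hP : DiscreteFamily P) {μ : ℝ} (h : P μ ≠ 0) : 0 < μ :=
  let ⟨_, hc, hc'⟩ := hP.gap
  hc.trans_le (hc' μ h)

theorem sum_le_of_mem (hP : DiscreteFamily P) (hd : 0 ≤ d) {x : H}
    (hx : x ∈ energySet P d C) (F : Finset ℝ) :
    ∑ μ ∈ F, (μ + d) * ‖P μ x‖ ^ 2 ≤ C ^ 2 := by
  calc ∑ μ ∈ F, (μ + d) * ‖P μ x‖ ^ 2 = ∑ μ ∈ F, √(μ + d) ^ 2 * ‖P μ x‖ ^ 2 := by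
        refine Finset.sum_congr rfl fun μ _ => ?_
        by_cases h : P μ = 0
        · simp [h]
        · rw [Real.sq_sqrt (add_nonneg (hP.pos h).le hd)]
    _ = ‖∑ μ ∈ F, √(μ + d) • P μ x‖ ^ 2 := (hP.norm_sq_sum _ F x).symm
    _ ≤ C ^ 2 := by gcongr; exact hx F

theorem sum_sq_le_of_mem (hP : DiscreteFamily P) (hd : 0 ≤ d) {x : H}
    (hx : x ∈ energySet P d C) {g : ℝ → ℝ} {κ : ℝ}
    (hκ : 0 ≤ κ) (hg : ∀ μ, P μ ≠ 0 → g μ ^ 2 ≤ κ * (μ + d)) (F : Finset ℝ) :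
    ∑ μ ∈ F, g μ ^ 2 * ‖P μ x‖ ^ 2 ≤ κ * C ^ 2 := by
  calc ∑ μ ∈ F, g μ ^ 2 * ‖P μ x‖ ^ 2 ≤ ∑ μ ∈ F, κ * ((μ + d) * ‖P μ x‖ ^ 2) := by
        refine Finset.sum_le_sum fun μ _ => ?_
        by_cases h : P μ = 0
        · simp [h]
        · rw [← mul_assoc]
          gcongr
          exact hg μ h
    _ ≤ κ * C ^ 2 := by
      rw [← Finset.mul_sum]
      gcongr
      exact hP.sum_le_of_mem hd hx F

theorem norm_sq_le_of_mem (hP : DiscreteFamily P) (hd : 0 ≤ d) {x y : H}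
    (hx : x ∈ energySet P d C) {g : ℝ → ℝ} {κ : ℝ}
    (hκ : 0 ≤ κ) (hg : ∀ μ, P μ ≠ 0 → g μ ^ 2 ≤ κ * (μ + d))
    (hy : HasSum (fun μ => g μ • P μ x) y) : ‖y‖ ^ 2 ≤ κ * C ^ 2 :=
  hasSum_le_of_sum_le (hP.hasSum_norm_sq_of_hasSum hy) (hP.sum_sq_le_of_mem hd hx hκ hg)

theorem exists_norm_le (hP : DiscreteFamily P) (hd : 0 ≤ d) : ∃ ρ, ∀ x ∈ energySet P d C, ‖x‖ ≤ ρ := by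
  obtain ⟨c, hc, hc'⟩ := hP.gap
  refine ⟨√(c⁻¹ * C ^ 2), fun x hx => Real.le_sqrt_of_sq_le ?_⟩
  refine hP.norm_sq_le_of_mem hd hx (g := fun _ => 1) (inv_nonneg.2 hc.le) (fun μ hμ => ?_) ?_
  · rw [one_pow, inv_mul_eq_div, le_div_iff₀ hc]
    linarith [hc' μ hμ]
  · simpa using hP.hasSum x

theorem isCompact_energySet (hP : DiscreteFamily P) [CompleteSpace H] (hd : 0 ≤ d) : IsCompact (energySet P d C) := by
  refine TotallyBounded.isCompact_of_isClosed (Metric.totallyBounded_iff.2 fun ε hε => ?_)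
    isClosed_energySet
  obtain ⟨ρ, hρ⟩ := hP.exists_norm_le (C := C) hd
  obtain ⟨N, hN0, hN⟩ : ∃ N : ℝ, 0 < N ∧ N⁻¹ * C ^ 2 < (ε / 2) ^ 2 := by
    have h : Tendsto (fun N : ℝ => N⁻¹ * C ^ 2) atTop (𝓝 0) := by
      simpa using tendsto_inv_atTop_zero.mul_const (C ^ 2)
    exact ((eventually_gt_atTop 0).and (h.eventually_lt_const (by positivity))).exists
  obtain ⟨K, hKc, hK⟩ := hP.compact N ρ
  obtain ⟨t, ht, ht'⟩ := Metric.totallyBounded_iff.1 hKc.totallyBounded (ε / 2) (half_pos hε)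
  refine ⟨t, ht, fun x hx => ?_⟩
  let g : ℝ → ℝ := fun μ => if μ ≤ N then 1 else 0
  have hg : ∀ μ, P μ ≠ 0 → |g μ| ≤ 1 := fun μ _ => by
    simp only [g]
    split_ifs <;> simp
  have hs := hP.hasSum_diag hg x
  have hy : hP.diag g x ∈ K := by
    refine hK _ ?_ fun μ hμ => ?_
    · have h := hP.norm_le_of_hasSum zero_le_one hg hs
      rw [one_mul] at h
      exact h.trans (hρ x hx)
    · rw [hP.apply_diag hg]
      simp [g, not_le.2 hμ]
  have h1 : HasSum (fun μ => (1 - g μ) • P μ x) (x - hP.diag g x) := by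
    simpa only [sub_smul, one_smul] using (hP.hasSum x).sub hs
  have h2 := hP.norm_sq_le_of_mem hd hx (inv_nonneg.2 hN0.le) (fun μ hμ => by
    have h3 := hP.pos hμ
    simp only [g]
    split_ifs with h
    · rw [sub_self, zero_pow two_ne_zero]
      positivity
    · rw [sub_zero, one_pow, inv_mul_eq_div, le_div_iff₀ hN0]
      linarith) h1
  have h3 : ‖x - hP.diag g x‖ < ε / 2 := lt_of_pow_lt_pow_left₀ 2 (by positivity) (h2.trans_lt hN)
  obtain ⟨y, hyt, hy'⟩ := mem_iUnion₂.1 (ht' hy)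
  refine mem_iUnion₂.2 ⟨y, hyt, ?_⟩
  rw [Metric.mem_ball] at hy' ⊢
  rw [← dist_eq_norm] at h3
  linarith [dist_triangle x (hP.diag g x) y]

theorem abs_exp_le (hP : DiscreteFamily P) (hd : 0 ≤ d) (t μ : ℝ) (hμ : P μ ≠ 0) :
    |Real.exp (-((μ + d) * max t 0))| ≤ 1 := by
  rw [Real.abs_exp, Real.exp_le_one_iff]
  have := hP.pos hμ
  have := le_max_right t 0
  exact neg_nonpos.2 (by positivity)

end DiscreteFamily

end EnergySet

section Evolution

variable {H : Type*} [NormedAddCommGroup H] [InnerProductSpace ℝ H] [CompleteSpace H]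
  {P : ℝ → H →L[ℝ] H} {d : ℝ}

/-- The semigroup `e^{-(A + d) t}` for `t ≥ 0`, extended by the identity to `t ≤ 0`. -/
noncomputable def evol (hP : DiscreteFamily P) (d t : ℝ) : H →L[ℝ] H :=
  hP.diag fun μ => Real.exp (-((μ + d) * max t 0))

variable (hP : DiscreteFamily P)

namespace DiscreteFamily

theorem hasSum_evol (hd : 0 ≤ d) (t : ℝ) (x : H) :
    HasSum (fun μ => Real.exp (-((μ + d) * max t 0)) • P μ x) (evol hP d t x) :=
  hP.hasSum_diag (hP.abs_exp_le hd t) x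

theorem apply_evol (hd : 0 ≤ d) (t : ℝ) (x : H) (μ : ℝ) :
    P μ (evol hP d t x) = Real.exp (-((μ + d) * max t 0)) • P μ x :=
  hP.apply_of_hasSum (hP.hasSum_evol hd t x) μ

theorem evol_of_nonpos (hd : 0 ≤ d) {t : ℝ} (ht : t ≤ 0) (x : H) : evol hP d t x = x :=
  hP.eq_of_forall fun μ => by simp [hP.apply_evol hd, ht]

theorem evol_add (hd : 0 ≤ d) {s t : ℝ} (hs : 0 ≤ s) (ht : 0 ≤ t) (x : H) :
    evol hP d (s + t) x = evol hP d s (evol hP d t x) :=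
  hP.eq_of_forall fun μ => by
    simp only [hP.apply_evol hd, max_eq_left hs, max_eq_left ht, max_eq_left (add_nonneg hs ht),
      smul_smul, ← Real.exp_add]
    ring_nf

theorem norm_evol_le (hd : 0 ≤ d) (t : ℝ) (x : H) : ‖evol hP d t x‖ ≤ ‖x‖ := by
  simpa using hP.norm_le_of_hasSum zero_le_one (hP.abs_exp_le hd t) (hP.hasSum_evol hd t x)

theorem norm_evol_le_exp (hd : 0 ≤ d) {c : ℝ} (hc : ∀ μ, P μ ≠ 0 → c ≤ μ) {t : ℝ} (ht : 0 ≤ t)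
    (x : H) : ‖evol hP d t x‖ ≤ Real.exp (-(c * t)) * ‖x‖ := by
  refine hP.norm_le_of_hasSum (Real.exp_pos _).le (fun μ hμ => ?_) (hP.hasSum_evol hd t x)
  rw [Real.abs_exp, max_eq_left ht]
  gcongr
  linarith [hc μ hμ]

theorem continuous_evol_apply (hd : 0 ≤ d) (x : H) : Continuous fun t => evol hP d t x := by
  have h : TendstoUniformly (fun (F : Finset ℝ) t => evol hP d t (∑ μ ∈ F, P μ x))
      (fun t => evol hP d t x) atTop := by
    rw [Metric.tendstoUniformly_iff]
    intro ε hε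
    filter_upwards [(Metric.tendsto_nhds.1 (hP.hasSum x)) ε hε] with F hF t
    rw [dist_comm, dist_eq_norm, ← map_sub]
    rw [dist_eq_norm] at hF
    exact (hP.norm_evol_le hd t _).trans_lt hF
  refine h.continuous (Frequently.of_forall fun F => ?_)
  simp only [map_sum]
  refine continuous_finsetSum _ fun μ _ => ?_
  have h1 : ∀ t, evol hP d t (P μ x) = Real.exp (-((μ + d) * max t 0)) • P μ x := fun t =>
    hP.eq_of_forall fun ν => by
      rw [hP.apply_evol hd, map_smul, hP.apply_apply]
      split_ifs with h
      · rw [h]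
      · simp
  simp only [h1]
  fun_prop

theorem continuous_evol (hd : 0 ≤ d) : Continuous fun p : ℝ × H => evol hP d p.1 p.2 := by
  have h : Continuous fun p : H × ℝ => evol hP d p.2 p.1 := by
    refine continuous_prod_of_continuous_lipschitzWith _ 1
      (fun x => hP.continuous_evol_apply hd x) fun t => LipschitzWith.of_dist_le_mul fun x y => ?_
    simp only [dist_eq_norm, NNReal.coe_one, one_mul, ← map_sub]
    exact hP.norm_evol_le hd t _
  exact h.comp continuous_swap

theorem evol_mem_energySet (hd : 0 ≤ d) {t : ℝ} (ht : 0 < t) (x : H) :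
    evol hP d t x ∈ energySet P d (t ^ (-(1 / 2) : ℝ) * ‖x‖) := by
  intro F
  refine le_of_sq_le_sq ?_ (by positivity)
  simp only [hP.apply_evol hd, max_eq_left ht.le, smul_smul]
  rw [hP.norm_sq_sum (fun μ => √(μ + d) * Real.exp (-((μ + d) * t))), mul_pow]
  calc ∑ μ ∈ F, (√(μ + d) * Real.exp (-((μ + d) * t))) ^ 2 * ‖P μ x‖ ^ 2
      ≤ ∑ μ ∈ F, (t ^ (-(1 / 2) : ℝ)) ^ 2 * ‖P μ x‖ ^ 2 := by
        refine Finset.sum_le_sum fun μ _ => ?_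
        by_cases h : P μ = 0
        · simp [h]
        gcongr ?_ * _
        have hw : 0 ≤ μ + d := add_nonneg (hP.pos h).le hd
        have h1 : (t ^ (-(1 / 2) : ℝ)) ^ 2 = t⁻¹ := by
          rw [← Real.rpow_natCast, ← Real.rpow_mul ht.le]
          norm_num
          exact Real.rpow_neg_one t
        rw [h1, mul_pow, Real.sq_sqrt hw, ← Real.exp_nat_mul, ← one_div, le_div_iff₀ ht]
        have h2 : (μ + d) * t ≤ Real.exp ((μ + d) * t) :=
          (by linarith : _ ≤ (μ + d) * t + 1).trans (Real.add_one_le_exp _)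
        have h3 : 0 ≤ (μ + d) * t := by positivity
        calc (μ + d) * Real.exp ((2 : ℕ) * -((μ + d) * t)) * t
            = (μ + d) * t * Real.exp ((2 : ℕ) * -((μ + d) * t)) := by ring
          _ ≤ Real.exp ((μ + d) * t) * Real.exp ((2 : ℕ) * -((μ + d) * t)) := by gcongr
          _ = Real.exp (-((μ + d) * t)) := by
            rw [← Real.exp_add]
            congr 1
            push_cast
            ring
          _ ≤ 1 := Real.exp_le_one_iff.2 (by linarith)
    _ ≤ (t ^ (-(1 / 2) : ℝ)) ^ 2 * ‖x‖ ^ 2 := by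
      rw [← Finset.mul_sum]
      gcongr
      exact hP.sum_norm_sq_le F x

theorem norm_evol_sub_le (hd : 0 ≤ d) {C : ℝ} (hC : 0 ≤ C) {x : H} (hx : x ∈ energySet P d C)
    {h : ℝ} (hh : 0 ≤ h) : ‖evol hP d h x - x‖ ≤ √h * C := by
  refine le_of_sq_le_sq ?_ (by positivity)
  rw [mul_pow, Real.sq_sqrt hh]
  have h1 := (hP.hasSum_evol hd h x).sub (hP.hasSum x)
  refine hP.norm_sq_le_of_mem hd hx (g := fun μ => Real.exp (-((μ + d) * max h 0)) - 1) hh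
    (fun μ hμ => ?_) (by simpa only [sub_smul, one_smul] using h1)
  rw [max_eq_left hh]
  have hw : 0 ≤ (μ + d) * h := mul_nonneg (add_nonneg (hP.pos hμ).le hd) hh
  have h2 := Real.add_one_le_exp (-((μ + d) * h))
  have h3 : Real.exp (-((μ + d) * h)) ≤ 1 := Real.exp_le_one_iff.2 (by linarith)
  have h4 := Real.exp_pos (-((μ + d) * h))
  nlinarith

end DiscreteFamily

end Evolution

/-- A set of continuous functions with values in given compact sets and a common modulus of
continuity is compact for the topology of locally uniform convergence. -/
theorem isCompact_setOf_modulus {X E : Type*} [TopologicalSpace X] [PseudoMetricSpace E]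
    [T2Space E] {Q : X → Set E}
    (hQ : ∀ t, IsCompact (Q t)) {m : X → X → ℝ} (hm : ∀ t, Tendsto (m t) (𝓝 t) (𝓝 0)) :
    IsCompact {g : C(X, E) | (∀ t, g t ∈ Q t) ∧ ∀ t s, dist (g t) (g s) ≤ m t s} := by
  refine ArzelaAscoli.isCompact_of_equicontinuous _ ?_ ?_
  · have h : ContinuousMap.toFun '' {g : C(X, E) | (∀ t, g t ∈ Q t) ∧
        ∀ t s, dist (g t) (g s) ≤ m t s} =
        (univ.pi Q) ∩ {g : X → E | ∀ t s, dist (g t) (g s) ≤ m t s} := by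
      ext g
      constructor
      · rintro ⟨g, ⟨h1, h2⟩, rfl⟩
        exact ⟨fun t _ => h1 t, h2⟩
      · rintro ⟨h1, h2⟩
        refine ⟨⟨g, continuous_iff_continuousAt.2 fun t => ?_⟩, ⟨fun t => h1 t trivial, h2⟩, rfl⟩
        rw [ContinuousAt, tendsto_iff_dist_tendsto_zero]
        exact squeeze_zero (fun _ => dist_nonneg) (fun s => by rw [dist_comm]; exact h2 t s) (hm t)
    rw [h]
    refine (isCompact_univ_pi hQ).inter_right ?_
    simp only [ofPred_forall]
    exact isClosed_iInter fun t => isClosed_iInter fun s => isClosed_le (by fun_prop) continuous_const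
  · intro t
    exact Metric.equicontinuousAt_of_continuity_modulus (m t) (hm t) _
      (Eventually.of_forall fun s g => g.2.2 t s)

section Duhamel

variable {H : Type*} [NormedAddCommGroup H] [InnerProductSpace ℝ H] [CompleteSpace H]
  {P : ℝ → H →L[ℝ] H} {d : ℝ}

/-- The Duhamel integral `∫₀ᵗ e^{-(A + d)(t - s)} f(s) ds`, extended by zero to `t ≤ 0`. -/
noncomputable def duhamel (hP : DiscreteFamily P) (d : ℝ) (f : ℝ → H) (t : ℝ) : H :=
  ∫ s in (0 : ℝ)..max t 0, evol hP d (max t 0 - s) (f s)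

variable (hP : DiscreteFamily P) {f : ℝ → H} {M : ℝ}

namespace DiscreteFamily

theorem continuous_evol_comp (hd : 0 ≤ d) {a : ℝ → ℝ} (ha : Continuous a) (hf : Continuous f) :
    Continuous fun s => evol hP d (a s) (f s) :=
  (hP.continuous_evol hd).comp (ha.prodMk hf)

theorem duhamel_of_nonpos {t : ℝ} (ht : t ≤ 0) : duhamel hP d f t = 0 := by
  rw [duhamel, max_eq_right ht, intervalIntegral.integral_same]

theorem duhamel_of_nonneg {t : ℝ} (ht : 0 ≤ t) :
    duhamel hP d f t = ∫ s in (0 : ℝ)..t, evol hP d (t - s) (f s) := by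
  rw [duhamel, max_eq_left ht]

theorem norm_integral_evol_le (hd : 0 ≤ d) (hM : ∀ s, ‖f s‖ ≤ M) {a b : ℝ} (hab : a ≤ b)
    (u : ℝ → ℝ) : ‖∫ s in a..b, evol hP d (u s) (f s)‖ ≤ M * (b - a) := by
  have h := intervalIntegral.norm_integral_le_of_norm_le_const (a := a) (b := b)
    (f := fun s => evol hP d (u s) (f s)) (C := M)
    fun s _ => (hP.norm_evol_le hd _ _).trans (hM s)
  rwa [abs_of_nonneg (sub_nonneg.2 hab)] at h

theorem duhamel_add (hd : 0 ≤ d) (hf : Continuous f) {a h : ℝ} (ha : 0 ≤ a) (hh : 0 ≤ h) :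
    duhamel hP d f (a + h) = evol hP d h (duhamel hP d f a) +
      ∫ s in a..a + h, evol hP d (a + h - s) (f s) := by
  have hc : ∀ b : ℝ, Continuous fun s => evol hP d (b - s) (f s) := fun b =>
    hP.continuous_evol_comp hd (by fun_prop) hf
  rw [hP.duhamel_of_nonneg ha, hP.duhamel_of_nonneg (add_nonneg ha hh),
    ← intervalIntegral.integral_add_adjacent_intervals ((hc _).intervalIntegrable 0 a)
      ((hc _).intervalIntegrable a _),
    ← ContinuousLinearMap.intervalIntegral_comp_comm _ ((hc _).intervalIntegrable _ _)]
  congr 1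
  refine intervalIntegral.integral_congr fun s hs => ?_
  rw [uIcc_of_le ha] at hs
  change evol hP d (a + h - s) (f s) = evol hP d h (evol hP d (a - s) (f s))
  rw [← hP.evol_add hd hh (sub_nonneg.2 hs.2)]
  congr 2
  ring

theorem integral_sub_rpow (t : ℝ) :
    ∫ s in (0 : ℝ)..t, (t - s) ^ (-(1 / 2) : ℝ) = 2 * √t := by
  rw [intervalIntegral.integral_comp_sub_left (fun x => x ^ (-(1 / 2) : ℝ)) t, sub_self, sub_zero,
    integral_rpow (Or.inl (by norm_num)), Real.sqrt_eq_rpow]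
  norm_num
  ring

theorem duhamel_mem_energySet (hd : 0 ≤ d) (hf : Continuous f) (hM : ∀ s, ‖f s‖ ≤ M) (t : ℝ) :
    duhamel hP d f t ∈ energySet P d (2 * √(max t 0) * M) := by
  intro F
  rw [duhamel]
  have ht := le_max_right t 0
  generalize max t 0 = t at ht ⊢
  let L : H →L[ℝ] H := ∑ μ ∈ F, √(μ + d) • P μ
  have hL : ∀ x, L x = ∑ μ ∈ F, √(μ + d) • P μ x := fun x => by simp [L]
  rw [← hL, ← ContinuousLinearMap.intervalIntegral_comp_comm _
    ((hP.continuous_evol_comp hd (by fun_prop) hf).intervalIntegrable _ _),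
    ← integral_sub_rpow t, ← intervalIntegral.integral_mul_const]
  refine intervalIntegral.norm_integral_le_of_norm_le ht ?_ ?_
  · have : ∀ᵐ s : ℝ, s ≠ t := by simp [ae_iff, measure_singleton]
    filter_upwards [this] with s hs hs'
    rw [hL]
    refine (hP.evol_mem_energySet hd (sub_pos.2 (lt_of_le_of_ne hs'.2 hs)) (f s) F).trans ?_
    gcongr
    · exact Real.rpow_nonneg (sub_nonneg.2 hs'.2) _
    · exact hM s
  · refine IntervalIntegrable.mul_const ?_ _
    have h := (intervalIntegral.intervalIntegrable_rpow' (a := 0) (b := t) (r := -(1 / 2))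
      (by norm_num)).comp_sub_left t
    rw [sub_zero, sub_self] at h
    exact h.symm

theorem norm_duhamel_le (hd : 0 ≤ d) {c : ℝ} (hc0 : 0 < c) (hc : ∀ μ, P μ ≠ 0 → c ≤ μ)
    (hM : ∀ s, ‖f s‖ ≤ M) (t : ℝ) : ‖duhamel hP d f t‖ ≤ M / c := by
  rw [duhamel]
  have ht := le_max_right t 0
  generalize max t 0 = t at ht ⊢
  have hM0 : 0 ≤ M := (norm_nonneg _).trans (hM 0)
  have h1 : ∫ s in (0 : ℝ)..t, Real.exp (-(c * (t - s))) = (1 - Real.exp (-(c * t))) / c := by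
    have h : ∀ s ∈ uIcc 0 t, HasDerivAt (fun s => Real.exp (-(c * (t - s))) / c)
        (Real.exp (-(c * (t - s)))) s := fun s _ => by
      have h2 : HasDerivAt (fun s => -(c * (t - s))) c s := by
        have h4 : HasDerivAt (fun s => -(c * (t - s))) (-(c * -1)) s :=
          (((hasDerivAt_id s).const_sub t).const_mul c).neg
        rwa [mul_neg_one, neg_neg] at h4
      have h3 := h2.exp.div_const c
      rwa [mul_div_cancel_right₀ _ hc0.ne'] at h3
    rw [intervalIntegral.integral_eq_sub_of_hasDerivAt h
      ((by fun_prop : Continuous fun s => Real.exp (-(c * (t - s)))).intervalIntegrable _ _)]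
    simp
    ring
  calc ‖∫ s in (0 : ℝ)..t, evol hP d (t - s) (f s)‖
      ≤ ∫ s in (0 : ℝ)..t, Real.exp (-(c * (t - s))) * M := by
        refine intervalIntegral.norm_integral_le_of_norm_le ht
          (Eventually.of_forall fun s hs => ?_)
          ((by fun_prop : Continuous fun s => Real.exp (-(c * (t - s))) * M).intervalIntegrable _ _)
        refine (hP.norm_evol_le_exp hd hc (sub_nonneg.2 hs.2) _).trans ?_
        gcongr
        exact hM s
    _ = (1 - Real.exp (-(c * t))) / c * M := by rw [intervalIntegral.integral_mul_const, h1]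
    _ ≤ 1 / c * M := by
      gcongr
      linarith [Real.exp_pos (-(c * t))]
    _ = M / c := by ring

/-- A modulus of continuity of Duhamel integrals. -/
noncomputable def _root_.DelayParabolic.duhamelModulus (M t s : ℝ) : ℝ :=
  √|t - s| * (2 * √|t| * M) + M * |t - s|

theorem dist_duhamel_le (hd : 0 ≤ d) (hf : Continuous f) (hM : ∀ s, ‖f s‖ ≤ M) (t s : ℝ) :
    dist (duhamel hP d f t) (duhamel hP d f s) ≤ duhamelModulus M t s := by
  have hM0 : 0 ≤ M := (norm_nonneg _).trans (hM 0)
  have key : ∀ a h b δ : ℝ, 0 ≤ a → 0 ≤ h → a ≤ b → h ≤ δ →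
      dist (duhamel hP d f (a + h)) (duhamel hP d f a) ≤ √δ * (2 * √b * M) + M * δ := by
    intro a h b δ ha hh hb hδ
    rw [dist_eq_norm, hP.duhamel_add hd hf ha hh, add_sub_right_comm]
    have hmem := hP.duhamel_mem_energySet hd hf hM a
    rw [max_eq_left ha] at hmem
    have h1 := hP.norm_evol_sub_le hd (by positivity) hmem hh
    have h2 := hP.norm_integral_evol_le hd hM (a := a) (b := a + h) (by linarith)
      fun s => a + h - s
    rw [add_sub_cancel_left] at h2
    calc _ ≤ √h * (2 * √a * M) + M * h := (norm_add_le _ _).trans (add_le_add h1 h2)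
      _ ≤ _ := by gcongr
  have hmax : ∀ t, duhamel hP d f t = duhamel hP d f (max t 0) := fun t => by
    simp only [duhamel, max_eq_left (le_max_right t 0)]
  have habs := abs_max_sub_max_le_abs t s 0
  have ht : max t 0 ≤ |t| := max_le (le_abs_self t) (abs_nonneg t)
  rw [hmax t, hmax s, duhamelModulus]
  rcases le_total (max t 0) (max s 0) with h | h
  · have h3 := key (max t 0) (max s 0 - max t 0) |t| |t - s| (le_max_right _ _) (sub_nonneg.2 h) ht
      (by rw [abs_sub_comm] at habs; exact (le_abs_self _).trans habs)
    rwa [add_sub_cancel, dist_comm] at h3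
  · have h3 := key (max s 0) (max t 0 - max s 0) |t| |t - s| (le_max_right _ _) (sub_nonneg.2 h)
      (h.trans ht) ((le_abs_self _).trans habs)
    rwa [add_sub_cancel] at h3

theorem _root_.DelayParabolic.tendsto_duhamelModulus (M t : ℝ) :
    Tendsto (duhamelModulus M t) (𝓝 t) (𝓝 0) := by
  have h : Continuous (duhamelModulus M t) := by
    unfold duhamelModulus
    fun_prop
  simpa [duhamelModulus] using h.tendsto t

theorem continuous_duhamel (hd : 0 ≤ d) (hf : Continuous f) (hM : ∀ s, ‖f s‖ ≤ M) :
    Continuous (duhamel hP d f) := by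
  refine continuous_iff_continuousAt.2 fun t => ?_
  rw [ContinuousAt, tendsto_iff_dist_tendsto_zero]
  exact squeeze_zero (fun _ => dist_nonneg)
    (fun s => by rw [dist_comm]; exact hP.dist_duhamel_le hd hf hM t s)
    (tendsto_duhamelModulus M t)

/-- A compact set of continuous functions that contains all Duhamel integrals of functions bounded
by `M`. -/
def _root_.DelayParabolic.duhamelSet (P : ℝ → H →L[ℝ] H) (d M : ℝ) : Set C(ℝ, H) :=
  {g | (∀ t, g t ∈ energySet P d (2 * √(max t 0) * M)) ∧
    ∀ t s, dist (g t) (g s) ≤ duhamelModulus M t s}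

theorem isCompact_duhamelSet (hP : DiscreteFamily P) (hd : 0 ≤ d) (M : ℝ) :
    IsCompact (duhamelSet P d M) :=
  isCompact_setOf_modulus (fun _ => hP.isCompact_energySet hd) (tendsto_duhamelModulus M)

theorem duhamel_mem_duhamelSet (hd : 0 ≤ d) (hf : Continuous f) (hM : ∀ s, ‖f s‖ ≤ M) :
    (⟨duhamel hP d f, hP.continuous_duhamel hd hf hM⟩ : C(ℝ, H)) ∈ duhamelSet P d M :=
  ⟨fun t => hP.duhamel_mem_energySet hd hf hM t, hP.dist_duhamel_le hd hf hM⟩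

theorem tendsto_duhamel (hd : 0 ≤ d) {f : ℕ → ℝ → H} {g : ℝ → H} (hf : ∀ n, Continuous (f n))
    (hM : ∀ n s, ‖f n s‖ ≤ M) (t : ℝ)
    (h : ∀ s, 0 ≤ s → Tendsto (fun n => f n s) atTop (𝓝 (g s))) :
    Tendsto (fun n => duhamel hP d (f n) t) atTop (𝓝 (duhamel hP d g t)) := by
  refine intervalIntegral.tendsto_integral_filter_of_dominated_convergence (fun _ => M)
    (Eventually.of_forall fun n =>
      (hP.continuous_evol_comp hd (by fun_prop) (hf n)).aestronglyMeasurable)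
    (Eventually.of_forall fun n => Eventually.of_forall fun s _ =>
      (hP.norm_evol_le hd _ _).trans (hM n s)) intervalIntegrable_const
    (Eventually.of_forall fun s hs => ?_)
  rw [uIoc_of_le (le_max_right t 0)] at hs
  exact ((evol hP d (max t 0 - s)).continuous.tendsto _).comp (h s hs.1.le)

end DiscreteFamily

end Duhamel

section

/-- Multiplication of an integrated differential equation by an exponential. -/
theorem exp_smul_eq_add_integral {E : Type*} [NormedAddCommGroup E] [NormedSpace ℝ E]
    [CompleteSpace E] {z k : ℝ → E} {z₀ : E} {T : ℝ} (a : ℝ)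
    (hk : Continuous k) (h : ∀ t ∈ Icc 0 T, z t = z₀ + ∫ s in (0 : ℝ)..t, k s) :
    ∀ t ∈ Icc 0 T, Real.exp (a * t) • z t =
      z₀ + ∫ s in (0 : ℝ)..t, Real.exp (a * s) • (k s + a • z s) := by
  intro t ht
  let Z : ℝ → E := fun t => z₀ + ∫ s in (0 : ℝ)..t, k s
  have hZ : ∀ s, HasDerivAt Z (k s) s := fun s =>
    (intervalIntegral.integral_hasDerivAt_right (hk.intervalIntegrable _ _)
      (hk.stronglyMeasurableAtFilter _ _) hk.continuousAt).const_add z₀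
  have hZc : Continuous Z := continuous_iff_continuousAt.2 fun s => (hZ s).continuousAt
  have he : ∀ s, HasDerivAt (fun s => Real.exp (a * s)) (Real.exp (a * s) * a) s := fun s => by
    have h1 : HasDerivAt (fun s => a * s) (a * 1) s := (hasDerivAt_id s).const_mul a
    rw [mul_one] at h1
    exact h1.exp
  have hY : ∀ s ∈ uIcc 0 t, HasDerivAt (fun s => Real.exp (a * s) • Z s)
      (Real.exp (a * s) • (k s + a • Z s)) s := fun s _ => by
    have h1 := (he s).smul (hZ s)
    rwa [mul_smul, ← smul_add] at h1
  have h2 := intervalIntegral.integral_eq_sub_of_hasDerivAt hY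
    ((by fun_prop : Continuous fun s => Real.exp (a * s) • (k s + a • Z s)).intervalIntegrable _ _)
  have h3 : Z 0 = z₀ := by simp [Z]
  rw [mul_zero, Real.exp_zero, one_smul, h3] at h2
  rw [h t ht, ← sub_eq_iff_eq_add']
  change Real.exp (a * t) • Z t - z₀ = _
  rw [← h2]
  refine intervalIntegral.integral_congr fun s hs => ?_
  rw [uIcc_of_le ht.1] at hs
  rw [h s ⟨hs.1, hs.2.trans ht.2⟩]

variable {H : Type*} [NormedAddCommGroup H] [InnerProductSpace ℝ H] [CompleteSpace H]
  {P : ℝ → H →L[ℝ] H} {d : ℝ}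

namespace DiscreteFamily

variable (hP : DiscreteFamily P)

theorem eq_evol_add_integral_iff (hd : 0 ≤ d) {g : ℝ → H} (hg : Continuous g) {t : ℝ} (ht : 0 ≤ t)
    (x y : H) :
    y = evol hP d t x + ∫ s in (0 : ℝ)..t, evol hP d (t - s) (g s) ↔
      ∀ μ, Real.exp ((μ + d) * t) • P μ y =
        P μ x + ∫ s in (0 : ℝ)..t, Real.exp ((μ + d) * s) • P μ (g s) := by
  have key : ∀ μ, P μ (evol hP d t x + ∫ s in (0 : ℝ)..t, evol hP d (t - s) (g s)) =
      Real.exp (-((μ + d) * t)) •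
        (P μ x + ∫ s in (0 : ℝ)..t, Real.exp ((μ + d) * s) • P μ (g s)) := by
    intro μ
    rw [map_add, ← ContinuousLinearMap.intervalIntegral_comp_comm _
      ((hP.continuous_evol_comp hd (by fun_prop) hg).intervalIntegrable _ _), smul_add,
      hP.apply_evol hd, max_eq_left ht, ← intervalIntegral.integral_smul]
    congr 1
    refine intervalIntegral.integral_congr fun s hs => ?_
    rw [uIcc_of_le ht] at hs
    change P μ (evol hP d (t - s) (g s)) = _
    rw [hP.apply_evol hd, max_eq_left (sub_nonneg.2 hs.2), smul_smul, ← Real.exp_add]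
    congr 2
    ring
  have hinv : ∀ μ (v w : H), Real.exp ((μ + d) * t) • v = w ↔
      v = Real.exp (-((μ + d) * t)) • w := fun μ v w => by
    rw [Real.exp_neg, eq_inv_smul_iff₀ (Real.exp_pos _).ne']
  constructor
  · intro h μ
    rw [hinv, ← key, ← h]
  · intro h
    refine hP.eq_of_forall fun μ => ?_
    rw [key, ← hinv, h]

/-- The zeroth order term of a linear inhomogeneous equation can be moved from the right-hand side
into the semigroup. -/
theorem mild_iff (hd : 0 ≤ d) {u f : ℝ → H} (hu : Continuous u) (hf : Continuous f) (x : H)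
    (T : ℝ) :
    (∀ t ∈ Icc 0 T, u t = evol hP 0 t x +
      ∫ s in (0 : ℝ)..t, evol hP 0 (t - s) (f s - d • u s)) ↔
    ∀ t ∈ Icc 0 T, u t = evol hP d t x + ∫ s in (0 : ℝ)..t, evol hP d (t - s) (f s) := by
  have h1 : (∀ t ∈ Icc 0 T, u t = evol hP 0 t x +
      ∫ s in (0 : ℝ)..t, evol hP 0 (t - s) (f s - d • u s)) ↔
      ∀ μ, ∀ t ∈ Icc 0 T, Real.exp (μ * t) • P μ (u t) =
        P μ x + ∫ s in (0 : ℝ)..t, Real.exp (μ * s) • P μ (f s - d • u s) := by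
    constructor
    · intro h μ t ht
      have := (hP.eq_evol_add_integral_iff le_rfl (by fun_prop) ht.1 x (u t)).1 (h t ht) μ
      simpa only [add_zero] using this
    · intro h t ht
      refine (hP.eq_evol_add_integral_iff le_rfl (by fun_prop) ht.1 x (u t)).2 fun μ => ?_
      simpa only [add_zero] using h μ t ht
  have h2 : (∀ t ∈ Icc 0 T, u t = evol hP d t x +
      ∫ s in (0 : ℝ)..t, evol hP d (t - s) (f s)) ↔
      ∀ μ, ∀ t ∈ Icc 0 T, Real.exp ((μ + d) * t) • P μ (u t) =
        P μ x + ∫ s in (0 : ℝ)..t, Real.exp ((μ + d) * s) • P μ (f s) :=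
    ⟨fun h μ t ht => (hP.eq_evol_add_integral_iff hd hf ht.1 x (u t)).1 (h t ht) μ,
      fun h t ht => (hP.eq_evol_add_integral_iff hd hf ht.1 x (u t)).2 fun μ => h μ t ht⟩
  rw [h1, h2]
  refine forall_congr' fun μ => ⟨fun h t ht => ?_, fun h t ht => ?_⟩
  · have h3 := exp_smul_eq_add_integral d (by fun_prop) h t ht
    rw [smul_smul, ← Real.exp_add] at h3
    rw [show (μ + d) * t = d * t + μ * t by ring, h3]
    congr 1
    refine intervalIntegral.integral_congr fun s _ => ?_
    simp only [map_sub, map_smul]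
    rw [smul_sub, smul_comm d, sub_add_cancel, smul_smul, ← Real.exp_add]
    congr 2
    ring
  · have h3 := exp_smul_eq_add_integral (-d) (by fun_prop) h t ht
    rw [smul_smul, ← Real.exp_add] at h3
    rw [show μ * t = -d * t + (μ + d) * t by ring, h3]
    congr 1
    refine intervalIntegral.integral_congr fun s _ => ?_
    simp only [map_sub, map_smul]
    rw [smul_comm (-d), ← smul_add, smul_smul, ← Real.exp_add, neg_smul, ← sub_eq_add_neg]
    congr 2
    ring

end DiscreteFamily

end

section

variable {H : Type*} [NormedAddCommGroup H] {r : ℝ≥0}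

theorem segment_apply (u : C(ℝ, H)) (t : ℝ) (θ : Icc (-(r : ℝ)) 0) :
    segment r u t θ = u (t + θ) := rfl

theorem continuous_segment : Continuous fun p : C(ℝ, H) × ℝ => segment r p.1 p.2 := by
  refine ContinuousMap.continuous_of_continuous_uncurry _ ?_
  have h : Continuous fun q : (C(ℝ, H) × ℝ) × Icc (-(r : ℝ)) 0 => q.1.1 (q.1.2 + q.2) := by
    fun_prop
  exact h

theorem continuous_segment_right (u : C(ℝ, H)) : Continuous (segment r u) :=
  continuous_segment.comp (Continuous.prodMk_right u)

theorem continuous_comp_segment {F : Hist r H → H} (hF : Continuous F) (u : C(ℝ, H)) :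
    Continuous fun s => F (segment r u s) :=
  hF.comp (continuous_segment_right u)

/-- The nonlinearity `F` depends on the future of a trajectory in a locally Lipschitz way: if two
trajectories agree on `[x - r, x]`, then `F` is Lipschitz along them for a short time. -/
def LipschitzAlong (F : Hist r H → H) : Prop :=
  ∀ (u v : C(ℝ, H)) (x : ℝ), (∀ σ ∈ Icc (x - r) x, u σ = v σ) →
    ∃ ε > 0, ∃ K ≥ 0, ∀ s ∈ Icc x (x + ε), ∀ m, (∀ σ ∈ Icc x s, ‖u σ - v σ‖ ≤ m) →
      ‖F (segment r u s) - F (segment r v s)‖ ≤ K * m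

theorem continuous_negPt : Continuous (negPt : Icc (0 : ℝ) r → Icc (-(r : ℝ)) 0) :=
  (continuous_subtype_val.neg).subtype_mk _

theorem continuous_delayTerm {B : H → H} (hB : Continuous B) {η : Hist r H → Icc (0 : ℝ) r}
    (hη : Continuous η) : Continuous (delayTerm B η) :=
  hB.comp (continuous_id.eval (continuous_negPt.comp hη))

/-- The value `φ(0)`. -/
def atZero (φ : Hist r H) : H := φ ⟨0, neg_nonpos.mpr r.2, le_rfl⟩

theorem norm_atZero_le (φ : Hist r H) : ‖atZero φ‖ ≤ ‖φ‖ := φ.norm_coe_le_norm _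

theorem segment_comp_add (u : C(ℝ, H)) (τ s : ℝ) :
    segment r (u.comp ⟨fun t => t + τ, by fun_prop⟩) s = segment r u (s + τ) := by
  ext θ
  change u (s + θ + τ) = u (s + τ + θ)
  congr 1
  ring

theorem ext_apply {T : ℝ≥0} (u : C(Icc (-(r : ℝ)) (T : ℝ), H)) {t : ℝ}
    (ht : t ∈ Icc (-(r : ℝ)) T) : ext u t = u ⟨t, ht⟩ :=
  IccExtend_of_mem _ _ ht

theorem segment_congr {u v : C(ℝ, H)} {x : ℝ} (h : ∀ σ ∈ Icc (x - r) x, u σ = v σ) :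
    segment r u x = segment r v x := by
  ext θ
  exact h _ ⟨by linarith [θ.2.1], by linarith [θ.2.2]⟩

/-- If `Θˡ > 0` at the common history, then the delay is determined by the past. -/
theorem exists_norm_delayTerm_sub_le_of_pos {B : H → H} {LB : ℝ≥0} (hB : LipschitzWith LB B)
    {η Θu Θl : Hist r H → Icc (0 : ℝ) r} (hΘl : Continuous Θl) (hH : IgnoresOutside η Θu Θl)
    {u v : C(ℝ, H)} {x : ℝ} (huv : ∀ σ ∈ Icc (x - r) x, u σ = v σ)
    (hpos : 0 < (Θl (segment r u x) : ℝ)) :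
    ∃ ε > 0, ∃ K ≥ 0, ∀ s ∈ Icc x (x + ε), ∀ m, (∀ σ ∈ Icc x s, ‖u σ - v σ‖ ≤ m) →
      ‖delayTerm B η (segment r u s) - delayTerm B η (segment r v s)‖ ≤ K * m := by
  set a : ℝ := (Θl (segment r u x) : ℝ) / 2 with ha
  have ha0 : 0 < a := half_pos hpos
  have hcont : Continuous fun s => (Θl (segment r u s) : ℝ) :=
    continuous_subtype_val.comp (hΘl.comp (continuous_segment_right u))
  have hev : ∀ᶠ s in 𝓝 x, a < (Θl (segment r u s) : ℝ) :=
    hcont.continuousAt.eventually_const_lt (half_lt_self hpos)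
  obtain ⟨δ, hδ, hδ'⟩ := Metric.eventually_nhds_iff.1 hev
  refine ⟨min (δ / 2) a, lt_min (half_pos hδ) ha0, LB, LB.2, fun s hs m hm => ?_⟩
  have hm0 : 0 ≤ m := (norm_nonneg _).trans (hm x (left_mem_Icc.2 hs.1))
  have h1 : s - x ≤ δ / 2 := by linarith [hs.2, min_le_left (δ / 2) a]
  have h2 : s - x ≤ a := by linarith [hs.2, min_le_right (δ / 2) a]
  have h3 : a < (Θl (segment r u s) : ℝ) := hδ' (by
    rw [Real.dist_eq, abs_of_nonneg (sub_nonneg.2 hs.1)]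
    linarith)
  have h4 : η (segment r v s) = η (segment r u s) := by
    refine hH _ _ fun θ _ hθ => ?_
    rw [segment_apply, segment_apply]
    exact (huv _ ⟨by linarith [θ.2.1, hs.1], by linarith⟩).symm
  rw [delayTerm, delayTerm, h4, segment_apply, segment_apply, ← dist_eq_norm]
  refine (hB.dist_le_mul _ _).trans (mul_le_mul_of_nonneg_left ?_ LB.2)
  rw [dist_eq_norm]
  set θ := negPt (η (segment r u s))
  rcases le_total (s + θ) x with h | h
  · rw [huv _ ⟨by linarith [θ.2.1, hs.1], h⟩, sub_self, norm_zero]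
    exact hm0
  · exact hm _ ⟨h, by linarith [θ.2.2]⟩

theorem norm_segment_sub_le {u v : C(ℝ, H)} {x s m : ℝ}
    (huv : ∀ σ ∈ Icc (x - r) x, u σ = v σ) (hs : x ≤ s) (hm : ∀ σ ∈ Icc x s, ‖u σ - v σ‖ ≤ m) :
    ‖segment r u s - segment r v s‖ ≤ m := by
  have hm0 : 0 ≤ m := (norm_nonneg _).trans (hm x (left_mem_Icc.2 hs))
  refine (ContinuousMap.norm_le _ hm0).2 fun θ => ?_
  rw [ContinuousMap.sub_apply, segment_apply, segment_apply]
  rcases le_total (s + θ) x with h | h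
  · rw [huv _ ⟨by linarith [θ.2.1], h⟩, sub_self, norm_zero]
    exact hm0
  · exact hm _ ⟨h, by linarith [θ.2.2]⟩

theorem exists_norm_delayTerm_sub_le_of_zero {B : H → H} {LB : ℝ≥0} (hB : LipschitzWith LB B)
    {η Θl : Hist r H → Icc (0 : ℝ) r} (hη : Continuous η) (hZ : ZeroSetConditions η Θl)
    {u v : C(ℝ, H)} {x : ℝ} (huv : ∀ σ ∈ Icc (x - r) x, u σ = v σ)
    (hzero : (Θl (segment r u x) : ℝ) = 0) :
    ∃ ε > 0, ∃ K ≥ 0, ∀ s ∈ Icc x (x + ε), ∀ m, (∀ σ ∈ Icc x s, ‖u σ - v σ‖ ≤ m) →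
      ‖delayTerm B η (segment r u s) - delayTerm B η (segment r v s)‖ ≤ K * m := by
  obtain ⟨⟨L, hL⟩, hηpos, ω, hω, Lη, hLη, hηlip⟩ := hZ
  have hψ : segment r u x ∈ zeroSet Θl := hzero
  have hψv : segment r v x = segment r u x := (segment_congr huv).symm
  have hlip := hL hψ
  set a : ℝ := (η (segment r u x) : ℝ) / 2 with ha
  have ha2 : a < (η (segment r u x) : ℝ) := half_lt_self (hηpos _ hψ)
  have hnear : ∀ w : C(ℝ, H), segment r w x = segment r u x →
      ∀ᶠ s in 𝓝 x, a < (η (segment r w s) : ℝ) ∧ segment r w s ∈ nbhd (zeroSet Θl) ω := by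
    intro w hw
    have hc1 : Continuous fun s => (η (segment r w s) : ℝ) :=
      continuous_subtype_val.comp (hη.comp (continuous_segment_right w))
    have hc2 : Continuous fun s => ‖segment r w s - segment r u x‖ :=
      ((continuous_segment_right w).sub continuous_const).norm
    have h1 := hc1.continuousAt.eventually_const_lt (show a < (η (segment r w x) : ℝ) by rwa [hw])
    have h2 := hc2.continuousAt.eventually_lt_const
      (show ‖segment r w x - segment r u x‖ < ω by rwa [hw, sub_self, norm_zero])
    filter_upwards [h1, h2] with s h1 h2 using ⟨h1, _, hψ, h2.le⟩
  obtain ⟨δ, hδ, hδ'⟩ := Metric.eventually_nhds_iff.1 ((hnear u rfl).and (hnear v hψv))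
  refine ⟨min (δ / 2) a, lt_min (half_pos hδ) (half_pos (hηpos _ hψ)), LB * (|L| * Lη),
    by positivity, fun s hs m hm => ?_⟩
  have h1 : s - x ≤ δ / 2 := by linarith [hs.2, min_le_left (δ / 2) a]
  have h2 : s - x ≤ a := by linarith [hs.2, min_le_right (δ / 2) a]
  obtain ⟨⟨hu1, hu2⟩, hv1, hv2⟩ := hδ' (y := s) (by
    rw [Real.dist_eq, abs_of_nonneg (sub_nonneg.2 hs.1)]
    linarith)
  have hval : ∀ (w : C(ℝ, H)), segment r w x = segment r u x → ∀ q : Icc (0 : ℝ) r, a < q →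
      ∃ hq : s - x - q ∈ Icc (-(r : ℝ)) 0,
        segment r w s (negPt q) = segment r u x ⟨s - x - q, hq⟩ := by
    intro w hw q hq
    have hq0 : s - x - q ∈ Icc (-(r : ℝ)) 0 := ⟨by linarith [q.2.2, hs.1], by linarith⟩
    refine ⟨hq0, ?_⟩
    rw [← DFunLike.congr_fun hw ⟨_, hq0⟩, segment_apply, segment_apply]
    congr 1
    simp only [negPt]
    ring
  obtain ⟨hq1, hq1'⟩ := hval u rfl _ hu1
  obtain ⟨hq2, hq2'⟩ := hval v hψv _ hv1
  rw [delayTerm, delayTerm, hq1', hq2', ← dist_eq_norm]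
  refine (hB.dist_le_mul _ _).trans ?_
  rw [mul_assoc]
  refine mul_le_mul_of_nonneg_left ?_ LB.2
  rw [dist_eq_norm]
  refine (hlip _ _).trans ?_
  have h5 := hηlip _ hu2 _ hv2
  have h6 := norm_segment_sub_le huv hs.1 hm
  calc L * |s - x - η (segment r u s) - (s - x - η (segment r v s))|
      ≤ |L| * |s - x - η (segment r u s) - (s - x - η (segment r v s))| := by
        gcongr
        exact le_abs_self L
    _ = |L| * |(η (segment r u s) : ℝ) - η (segment r v s)| := by
      rw [abs_sub_comm]
      congr 2
      ring
    _ ≤ |L| * (Lη * m) := by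
      gcongr
      exact h5.trans (by gcongr)
    _ = |L| * Lη * m := by ring

theorem lipschitzAlong_delayTerm {B : H → H} {LB : ℝ≥0} (hB : LipschitzWith LB B)
    {η Θu Θl : Hist r H → Icc (0 : ℝ) r} (hη : Continuous η) (hΘl : Continuous Θl)
    (hH : IgnoresOutside η Θu Θl) (hcase : (∀ φ, 0 < (Θl φ : ℝ)) ∨ ZeroSetConditions η Θl) :
    LipschitzAlong (delayTerm B η) := by
  intro u v x huv
  rcases (Θl (segment r u x)).2.1.lt_or_eq with h | h
  · exact exists_norm_delayTerm_sub_le_of_pos hB hΘl hH huv h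
  · rcases hcase with hI | hII
    · exact absurd h (hI _).ne
    · exact exists_norm_delayTerm_sub_le_of_zero hB hη hII huv h.symm

end

section

variable {H : Type*} [NormedAddCommGroup H] [InnerProductSpace ℝ H] [CompleteSpace H]
  {P : ℝ → H →L[ℝ] H} {d : ℝ} {r : ℝ≥0}

/-- The function equal to `φ` on `[-r, 0]`, to `e^{-(A + d)t} φ(0)` for `t ≥ 0` and to `φ(-r)` for
`t ≤ -r`. -/
noncomputable def freeEvol (hP : DiscreteFamily P) (d : ℝ) (φ : Hist r H) (t : ℝ) : H :=
  φ (projIcc (-(r : ℝ)) 0 (neg_nonpos.mpr r.2) t) + (evol hP d t (atZero φ) - atZero φ)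

/-- `u` solves `u(t) = e^{-(A + d)t} φ(0) + ∫₀ᵗ e^{-(A + d)(t - s)} F(u_s) ds` for `t ∈ [0, T]`,
with `u = φ` on `[-r, 0]`. -/
def IsSolOn (hP : DiscreteFamily P) (d : ℝ) (F : Hist r H → H) (φ : Hist r H) (T : ℝ)
    (u : C(ℝ, H)) : Prop :=
  (∀ θ : Icc (-(r : ℝ)) 0, u θ = φ θ) ∧
    ∀ t ∈ Icc 0 T, u t = evol hP d t (atZero φ) +
      ∫ s in (0 : ℝ)..t, evol hP d (t - s) (F (segment r u s))

/-- `u` solves the same equation for all `t ≥ 0`, and is constant on `(-∞, -r]`. -/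
def IsSol (hP : DiscreteFamily P) (d : ℝ) (F : Hist r H → H) (φ : Hist r H) (u : C(ℝ, H)) :
    Prop :=
  ∀ t, u t = freeEvol hP d φ t + duhamel hP d (fun s => F (segment r u s)) t

variable (hP : DiscreteFamily P) {F : Hist r H → H} {M : ℝ}

namespace DiscreteFamily

theorem freeEvol_of_nonpos (hd : 0 ≤ d) (φ : Hist r H) {t : ℝ} (ht : t ≤ 0) :
    freeEvol hP d φ t = φ (projIcc (-(r : ℝ)) 0 (neg_nonpos.mpr r.2) t) := by
  rw [freeEvol, hP.evol_of_nonpos hd ht, sub_self, add_zero]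

theorem freeEvol_of_nonneg (φ : Hist r H) {t : ℝ} (ht : 0 ≤ t) :
    freeEvol hP d φ t = evol hP d t (atZero φ) := by
  rw [freeEvol, projIcc_of_right_le _ ht]
  exact add_sub_cancel _ _

theorem continuous_freeEvol (hd : 0 ≤ d) :
    Continuous fun p : Hist r H × ℝ => freeEvol hP d p.1 p.2 := by
  have h0 : Continuous fun p : Hist r H × ℝ => atZero p.1 := by
    unfold atZero
    fun_prop
  have h1 : Continuous fun p : Hist r H × ℝ => evol hP d p.2 (atZero p.1) :=
    (hP.continuous_evol hd).comp (continuous_snd.prodMk h0)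
  have h2 : Continuous fun p : Hist r H × ℝ =>
      p.1 (projIcc (-(r : ℝ)) 0 (neg_nonpos.mpr r.2) p.2) :=
    continuous_fst.eval (continuous_projIcc.comp continuous_snd)
  exact h2.add (h1.sub h0)

/-- `freeEvol` as a continuous function of time. -/
noncomputable def _root_.DelayParabolic.freeEvolMap (hP : DiscreteFamily P) (hd : 0 ≤ d)
    (φ : Hist r H) : C(ℝ, H) :=
  ⟨freeEvol hP d φ, (hP.continuous_freeEvol hd).comp (Continuous.prodMk_right φ)⟩

theorem continuous_freeEvolMap (hd : 0 ≤ d) :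
    Continuous (freeEvolMap hP hd : Hist r H → C(ℝ, H)) :=
  ContinuousMap.continuous_of_continuous_uncurry _ (hP.continuous_freeEvol hd)

theorem _root_.DelayParabolic.IsSol.isSolOn {hP : DiscreteFamily P} (hd : 0 ≤ d) {φ : Hist r H}
    {u : C(ℝ, H)} (hu : IsSol hP d F φ u) (T : ℝ) : IsSolOn hP d F φ T u := by
  refine ⟨fun θ => ?_, fun t ht => ?_⟩
  · rw [hu, hP.freeEvol_of_nonpos hd _ θ.2.2, hP.duhamel_of_nonpos θ.2.2, add_zero, projIcc_val]
  · rw [← hP.duhamel_of_nonneg ht.1, ← hP.freeEvol_of_nonneg _ ht.1]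
    exact hu t

/-- Limits of approximate solutions are solutions. -/
theorem isSol_of_tendsto (hd : 0 ≤ d) (hF : Continuous F) {φ : ℕ → Hist r H} {φ₀ : Hist r H}
    (hφ : Tendsto φ atTop (𝓝 φ₀)) {v : ℕ → C(ℝ, H)} {v₀ : C(ℝ, H)} (hv : Tendsto v atTop (𝓝 v₀))
    {f : ℕ → ℝ → H} (hf : ∀ n, Continuous (f n)) (hM : ∀ n s, ‖f n s‖ ≤ M)
    (heq : ∀ n t, v n t = freeEvol hP d (φ n) t + duhamel hP d (f n) t)
    {ε : ℕ → ℝ} (hε : Tendsto ε atTop (𝓝 0))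
    (hfv : ∀ s, 0 ≤ s → ∀ᶠ n in atTop, f n s = F (segment r (v n) (s - ε n))) :
    IsSol hP d F φ₀ v₀ := by
  intro t
  have h1 : Tendsto (fun n => v n t) atTop (𝓝 (v₀ t)) :=
    ((continuous_eval_const t).tendsto v₀).comp hv
  have h2 : Tendsto (fun n => freeEvol hP d (φ n) t) atTop (𝓝 (freeEvol hP d φ₀ t)) :=
    (((hP.continuous_freeEvol hd).comp (Continuous.prodMk_left t)).tendsto φ₀).comp hφ
  have h3 : Tendsto (fun n => duhamel hP d (f n) t) atTop
      (𝓝 (duhamel hP d (fun s => F (segment r v₀ s)) t)) := by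
    refine hP.tendsto_duhamel hd hf hM t fun s hs => ?_
    have h4 : Tendsto (fun n => F (segment r (v n) (s - ε n))) atTop
        (𝓝 (F (segment r v₀ s))) := by
      have h5 : Tendsto (fun n => (v n, s - ε n)) atTop (𝓝 (v₀, s)) :=
        hv.prodMk_nhds (by simpa using hε.const_sub s)
      exact ((hF.comp continuous_segment).tendsto (v₀, s)).comp h5
    exact h4.congr' ((hfv s hs).mono fun _ h => h.symm)
  simp only [heq] at h1
  exact tendsto_nhds_unique h1 (h2.add h3)

/-- Compactness of sequences of approximate solutions. -/
theorem exists_tendsto_subseq (hd : 0 ≤ d) {φ : ℕ → Hist r H} {φ₀ : Hist r H}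
    (hφ : Tendsto φ atTop (𝓝 φ₀)) {v : ℕ → C(ℝ, H)} {f : ℕ → ℝ → H} (hf : ∀ n, Continuous (f n))
    (hM : ∀ n s, ‖f n s‖ ≤ M)
    (heq : ∀ n t, v n t = freeEvol hP d (φ n) t + duhamel hP d (f n) t) :
    ∃ (v₀ : C(ℝ, H)) (k : ℕ → ℕ), StrictMono k ∧ Tendsto (v ∘ k) atTop (𝓝 v₀) := by
  let g : ℕ → C(ℝ, H) := fun n => ⟨duhamel hP d (f n), hP.continuous_duhamel hd (hf n) (hM n)⟩
  obtain ⟨g₀, -, k, hk, hlim⟩ := (hP.isCompact_duhamelSet hd M).tendsto_subseq (x := g)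
    fun n => hP.duhamel_mem_duhamelSet hd (hf n) (hM n)
  have h1 : Tendsto (fun n => freeEvolMap hP hd (φ n)) atTop (𝓝 (freeEvolMap hP hd φ₀)) :=
    ((hP.continuous_freeEvolMap hd).tendsto φ₀).comp hφ
  refine ⟨freeEvolMap hP hd φ₀ + g₀, k, hk, ((h1.comp hk.tendsto_atTop).add hlim).congr fun n => ?_⟩
  ext t
  exact (heq (k n) t).symm

/-- The fixed point map of the equation with an additional delay `ε`. -/
noncomputable def _root_.DelayParabolic.delayedMap (hP : DiscreteFamily P) (hd : 0 ≤ d)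
    (hF : Continuous F) (hM : ∀ φ, ‖F φ‖ ≤ M) (φ : Hist r H) (ε : ℝ) (u : C(ℝ, H)) : C(ℝ, H) :=
  ⟨fun t => freeEvol hP d φ t + duhamel hP d (fun s => F (segment r u (s - ε))) t,
    ((hP.continuous_freeEvol hd).comp (Continuous.prodMk_right φ)).add
      (hP.continuous_duhamel hd
        ((continuous_comp_segment hF u).comp (continuous_id.sub continuous_const))
        fun _ => hM _)⟩

theorem delayedMap_iterate (hd : 0 ≤ d) (hF : Continuous F) (hM : ∀ φ, ‖F φ‖ ≤ M) (φ : Hist r H)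
    (ε : ℝ) (u : C(ℝ, H)) (k : ℕ) :
    ∀ t ≤ k * ε, (delayedMap hP hd hF hM φ ε)^[k + 2] u t =
      (delayedMap hP hd hF hM φ ε)^[k + 1] u t := by
  induction k with
  | zero =>
    intro t ht
    rw [Nat.cast_zero, zero_mul] at ht
    rw [Function.iterate_succ_apply', Function.iterate_succ_apply']
    simp only [delayedMap, ContinuousMap.coe_mk, hP.duhamel_of_nonpos ht]
  | succ k ih =>
    intro t ht
    rw [Function.iterate_succ_apply', Function.iterate_succ_apply' _ (k + 1)]
    simp only [delayedMap, ContinuousMap.coe_mk]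
    congr 1
    rcases le_total t 0 with h0 | h0
    · rw [hP.duhamel_of_nonpos h0, hP.duhamel_of_nonpos h0]
    · rw [hP.duhamel_of_nonneg h0, hP.duhamel_of_nonneg h0]
      refine intervalIntegral.integral_congr fun s hs => ?_
      rw [uIcc_of_le h0] at hs
      refine congrArg (fun ψ => evol hP d (t - s) (F ψ)) ?_
      ext θ
      have h1 : s - ε + θ ≤ k * ε := by
        push_cast at ht
        linarith [hs.2, θ.2.2]
      have h2 := ih _ h1
      rw [Function.iterate_succ_apply' _ (k + 1)] at h2
      exact h2

theorem exists_isSol (hd : 0 ≤ d) (hF : Continuous F) (hM : ∀ φ, ‖F φ‖ ≤ M) (φ : Hist r H) :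
    ∃ u : C(ℝ, H), IsSol hP d F φ u := by
  let ε : ℕ → ℝ := fun n => 1 / ((n : ℝ) + 1)
  have hε : Tendsto ε atTop (𝓝 0) := tendsto_one_div_add_atTop_nhds_zero_nat
  let w : ℕ → C(ℝ, H) := fun n =>
    (delayedMap hP hd hF hM φ (ε n))^[(n + 1) * (n + 1) + 1] (freeEvolMap hP hd φ)
  let v : ℕ → C(ℝ, H) := fun n => delayedMap hP hd hF hM φ (ε n) (w n)
  have hvw : ∀ n : ℕ, ∀ t ≤ (n : ℝ) + 1, v n t = w n t := by
    intro n t ht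
    have h := hP.delayedMap_iterate hd hF hM φ (ε n) (freeEvolMap hP hd φ) ((n + 1) * (n + 1)) t
      (ht.trans_eq (by
        simp only [ε]
        push_cast
        field_simp))
    rwa [Function.iterate_succ_apply'] at h
  let f : ℕ → ℝ → H := fun n s => F (segment r (w n) (s - ε n))
  have hf : ∀ n, Continuous (f n) := fun n =>
    (continuous_comp_segment hF (w n)).comp (continuous_id.sub continuous_const)
  have hfM : ∀ n s, ‖f n s‖ ≤ M := fun n s => hM _
  have heq : ∀ n t, v n t = freeEvol hP d φ t + duhamel hP d (f n) t := fun n t => rfl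
  obtain ⟨v₀, k, hk, hlim⟩ := hP.exists_tendsto_subseq hd (tendsto_const_nhds (x := φ)) hf hfM heq
  refine ⟨v₀, hP.isSol_of_tendsto hd hF (tendsto_const_nhds (x := φ)) hlim (fun n => hf (k n))
    (fun n => hfM (k n)) (fun n => heq (k n)) (hε.comp hk.tendsto_atTop) fun s _ => ?_⟩
  filter_upwards [hk.tendsto_atTop.eventually_ge_atTop ⌈s⌉₊] with n hn
  refine congrArg F ?_
  ext θ
  refine (hvw (k n) _ ?_).symm
  have h1 : s ≤ k n := (Nat.le_ceil s).trans (by exact_mod_cast hn)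
  have h2 : 0 ≤ ε (k n) := by positivity
  have h3 := θ.2.2
  change s - ε (k n) + θ ≤ k n + 1
  linarith

theorem eqOn_of_isSolOn (hd : 0 ≤ d) (hF : Continuous F) (hL : LipschitzAlong F) {φ : Hist r H}
    {T : ℝ} {u v : C(ℝ, H)} (hu : IsSolOn hP d F φ T u) (hv : IsSolOn hP d F φ T v) :
    ∀ t ∈ Icc (-(r : ℝ)) T, u t = v t := by
  have hpast : ∀ t ∈ Icc (-(r : ℝ)) 0, u t = v t := fun t ht =>
    (hu.1 ⟨t, ht⟩).trans (hv.1 ⟨t, ht⟩).symm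
  rcases lt_or_ge T 0 with hT | hT
  · exact fun t ht => hpast t ⟨ht.1, ht.2.trans hT.le⟩
  let S : Set ℝ := {t | ∀ σ ∈ Ici (-(r : ℝ)), u (min σ t) = v (min σ t)}
  have hS : ∀ t, t ∈ S → ∀ σ ∈ Icc (-(r : ℝ)) t, u σ = v σ := fun t ht σ hσ => by
    simpa [min_eq_left hσ.2] using ht σ hσ.1
  have hS' : ∀ t, -(r : ℝ) ≤ t → (∀ σ ∈ Icc (-(r : ℝ)) t, u σ = v σ) → t ∈ S :=
    fun t ht h σ hσ => h _ ⟨le_min hσ ht, min_le_right _ _⟩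
  have hr : -(r : ℝ) ≤ 0 := neg_nonpos.2 r.2
  have hcl : IsClosed S := by
    simp only [S, ofPred_forall]
    exact isClosed_iInter fun σ => isClosed_iInter fun _ => isClosed_eq (by fun_prop) (by fun_prop)
  have hsub : Icc 0 T ⊆ S := by
    refine IsClosed.Icc_subset_of_forall_mem_nhdsWithin (hcl.inter isClosed_Icc)
      (hS' 0 hr hpast) fun x hx => ?_
    have hx0 : 0 ≤ x := hx.2.1
    have huvx := hS x hx.1
    obtain ⟨ε, hε, K, hK, hlip⟩ := hL u v x fun σ hσ => huvx σ ⟨by linarith [hσ.1], hσ.2⟩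
    set δ : ℝ := min (min ε (T - x)) (1 / (2 * (K + 1))) with hδ
    have hδ0 : 0 < δ := lt_min (lt_min hε (sub_pos.2 hx.2.2)) (by positivity)
    have hδε : δ ≤ ε := (min_le_left _ _).trans (min_le_left _ _)
    have hδT : δ ≤ T - x := (min_le_left _ _).trans (min_le_right _ _)
    have hδK : K * δ ≤ 1 / 2 := by
      have h1 : δ ≤ 1 / (2 * (K + 1)) := min_le_right _ _
      rw [le_div_iff₀ (by positivity)] at h1
      nlinarith
    obtain ⟨t₁, ht₁, hmax⟩ := isCompact_Icc.exists_isMaxOn (nonempty_Icc.2 (by linarith : x ≤ x + δ))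
      ((by fun_prop : Continuous fun t => ‖u t - v t‖).continuousOn)
    set m := ‖u t₁ - v t₁‖
    have hbound : ∀ t ∈ Icc x (x + δ), ‖u t - v t‖ ≤ m / 2 := by
      intro t ht
      have ht0 : 0 ≤ t := hx0.trans ht.1
      have htT : t ≤ T := by linarith [ht.2]
      let D : ℝ → H := fun s => evol hP d (t - s) (F (segment r u s) - F (segment r v s))
      have hcu := hP.continuous_evol_comp hd (by fun_prop : Continuous fun s => t - s)
        (continuous_comp_segment hF u)
      have hcv := hP.continuous_evol_comp hd (by fun_prop : Continuous fun s => t - s)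
        (continuous_comp_segment hF v)
      have hD : Continuous D := hP.continuous_evol_comp hd (by fun_prop)
        ((continuous_comp_segment hF u).sub (continuous_comp_segment hF v))
      have h1 : u t - v t = ∫ s in x..t, D s := by
        have h2 : ∫ s in (0 : ℝ)..x, D s = 0 := by
          refine (intervalIntegral.integral_congr (g := fun _ => 0) fun s hs => ?_).trans
            intervalIntegral.integral_zero
          rw [uIcc_of_le hx0] at hs
          have h3 : segment r u s = segment r v s := segment_congr fun σ hσ =>
            huvx σ ⟨by linarith [hσ.1, hs.1], hσ.2.trans hs.2⟩
          simp only [D, h3, sub_self, map_zero]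
        rw [hu.2 t ⟨ht0, htT⟩, hv.2 t ⟨ht0, htT⟩, add_sub_add_left_eq_sub,
          ← intervalIntegral.integral_sub (hcu.intervalIntegrable _ _)
            (hcv.intervalIntegrable _ _)]
        simp only [← map_sub]
        rw [← intervalIntegral.integral_add_adjacent_intervals (hD.intervalIntegrable 0 x)
          (hD.intervalIntegrable x t), h2, zero_add]
      have h4 : ‖∫ s in x..t, D s‖ ≤ K * m * |t - x| := by
        refine intervalIntegral.norm_integral_le_of_norm_le_const fun s hs => ?_
        rw [uIoc_of_le ht.1] at hs
        refine (hP.norm_evol_le hd _ _).trans (hlip s ⟨hs.1.le, by linarith [hs.2, ht.2]⟩ m ?_)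
        exact fun σ hσ => hmax ⟨hσ.1, by linarith [hσ.2, hs.2, ht.2]⟩
      rw [h1]
      refine h4.trans ?_
      rw [abs_of_nonneg (sub_nonneg.2 ht.1)]
      have hm0 : 0 ≤ m := norm_nonneg _
      calc K * m * (t - x) ≤ K * m * δ := by gcongr; linarith [ht.2]
        _ = K * δ * m := by ring
        _ ≤ 1 / 2 * m := by gcongr
        _ = m / 2 := by ring
    have hm : m ≤ 0 := by linarith [hbound t₁ ht₁]
    refine mem_nhdsGT_iff_exists_Ioc_subset.2 ⟨x + δ, by simpa using hδ0, fun y hy => ?_⟩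
    refine hS' y (by linarith [hy.1]) fun σ hσ => ?_
    rcases le_total σ x with h | h
    · exact huvx σ ⟨hσ.1, h⟩
    · have h5 := hbound σ ⟨h, hσ.2.trans hy.2⟩
      exact sub_eq_zero.1 (norm_le_zero_iff.1 (by linarith))
  intro t ht
  rcases le_total t 0 with h | h
  · exact hpast t ⟨ht.1, h⟩
  · exact hS t (hsub ⟨h, ht.2⟩) t ⟨ht.1, le_rfl⟩

theorem isSol_unique (hd : 0 ≤ d) (hF : Continuous F) (hL : LipschitzAlong F) {φ : Hist r H}
    {u v : C(ℝ, H)} (hu : IsSol hP d F φ u) (hv : IsSol hP d F φ v) : u = v := by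
  ext t
  rcases le_total t (-(r : ℝ)) with h | h
  · have h0 : t ≤ 0 := h.trans (neg_nonpos.2 r.2)
    rw [hu, hv, hP.duhamel_of_nonpos h0, hP.duhamel_of_nonpos h0]
  · exact hP.eqOn_of_isSolOn hd hF hL (hu.isSolOn hd t) (hv.isSolOn hd t) t ⟨h, le_rfl⟩

/-- Solutions depend continuously on the initial function. -/
theorem tendsto_sol (hd : 0 ≤ d) (hF : Continuous F) (hM : ∀ φ, ‖F φ‖ ≤ M)
    (hL : LipschitzAlong F) {φ : ℕ → Hist r H} {φ₀ : Hist r H} (hφ : Tendsto φ atTop (𝓝 φ₀))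
    {v : ℕ → C(ℝ, H)} {v₀ : C(ℝ, H)} (hv : ∀ n, IsSol hP d F (φ n) (v n))
    (hv₀ : IsSol hP d F φ₀ v₀) : Tendsto v atTop (𝓝 v₀) := by
  refine tendsto_of_subseq_tendsto fun ns hns => ?_
  have hφ' := hφ.comp hns
  have hf : ∀ n, Continuous fun s => F (segment r (v (ns n)) s) := fun n =>
    continuous_comp_segment hF _
  obtain ⟨w, k, hk, hlim⟩ := hP.exists_tendsto_subseq hd hφ' (v := fun n => v (ns n)) hf
    (fun _ _ => hM _) (fun n => hv (ns n))
  refine ⟨k, ?_⟩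
  have hw : IsSol hP d F φ₀ w := hP.isSol_of_tendsto hd hF (hφ'.comp hk.tendsto_atTop) hlim
    (fun n => hf (k n)) (fun _ _ => hM _) (fun n => hv (ns (k n))) (tendsto_const_nhds (x := 0))
    fun s _ => Eventually.of_forall fun n => by simp
  rw [← hP.isSol_unique hd hF hL hw hv₀]
  exact hlim

end DiscreteFamily

end

section

/-- A dynamical system with a compact set absorbing all bounded sets has a compact global
attractor. -/
theorem IsDynamicalSystem.exists_isCompactGlobalAttractor {X : Type*} [MetricSpace X] [Nonempty X]
    {S : ℝ≥0 → X → X} (hS : IsDynamicalSystem S) {K : Set X} (hK : IsCompact K)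
    (habs : ∀ D : Set X, Bornology.IsBounded D → ∃ t₀, ∀ t ≥ t₀, ∀ x ∈ D, S t x ∈ K) :
    ∃ 𝒜, IsCompactGlobalAttractor S 𝒜 := by
  obtain ⟨t₀, ht₀⟩ := habs K hK.isBounded
  have hKne : K.Nonempty := by
    obtain ⟨x⟩ := ‹Nonempty X›
    obtain ⟨t, ht⟩ := habs {x} Bornology.isBounded_singleton
    exact ⟨_, ht t le_rfl x rfl⟩
  let V : ℝ≥0 → Set X := fun t => S t '' K
  have hVc : ∀ t, IsCompact (V t) := fun t => hK.image (hS.continuous t)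
  have hVanti : ∀ s t, s + t₀ ≤ t → V t ⊆ V s := by
    rintro s t hst _ ⟨x, hx, rfl⟩
    have h1 : t₀ ≤ t - s := le_tsub_of_add_le_left hst
    refine ⟨S (t - s) x, ht₀ _ h1 x hx, ?_⟩
    rw [hS.add, add_tsub_cancel_of_le (le_self_add.trans hst)]
  have hdir : Directed (· ⊇ ·) V := fun s t =>
    ⟨max s t + t₀, hVanti s _ (by gcongr; exact le_max_left _ _),
      hVanti t _ (by gcongr; exact le_max_right _ _)⟩
  refine ⟨⋂ t, V t, ?_, ?_, ?_, ?_⟩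
  · exact IsCompact.nonempty_iInter_of_directed_nonempty_isCompact_isClosed V hdir
      (fun t => hKne.image _) hVc fun t => (hVc t).isClosed
  · exact (hVc 0).of_isClosed_subset (isClosed_iInter fun t => (hVc t).isClosed)
      (iInter_subset _ _)
  · intro s
    refine Subset.antisymm ?_ fun y hy => ?_
    · rintro _ ⟨x, hx, rfl⟩
      refine mem_iInter.2 fun t => ?_
      obtain ⟨z, hz, rfl⟩ := mem_iInter.1 hx (t + t₀)
      refine hVanti t (s + (t + t₀)) le_add_self ⟨z, hz, ?_⟩
      rw [hS.add]
    · have hcl : IsClosed (S s ⁻¹' {y}) := isClosed_singleton.preimage (hS.continuous s)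
      have hne : (⋂ t, V t ∩ S s ⁻¹' {y}).Nonempty := by
        refine IsCompact.nonempty_iInter_of_directed_nonempty_isCompact_isClosed _
          (fun a b => ?_) (fun t => ?_) (fun t => (hVc t).inter_right hcl)
          fun t => (hVc t).isClosed.inter hcl
        · obtain ⟨c, hc1, hc2⟩ := hdir a b
          exact ⟨c, inter_subset_inter_left _ hc1, inter_subset_inter_left _ hc2⟩
        · obtain ⟨z, hz, hzy⟩ := mem_iInter.1 hy (s + t)
          exact ⟨S t z, ⟨z, hz, rfl⟩, by rw [mem_preimage, hS.add, hzy]; rfl⟩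
      obtain ⟨x, hx⟩ := hne
      rw [← iInter_inter] at hx
      exact ⟨x, hx.1, hx.2⟩
  · intro D hD ε hε
    obtain ⟨t₁, ht₁⟩ := habs D hD
    obtain ⟨t₂, ht₂⟩ := exists_subset_nhds_of_isCompact' hdir hVc (fun t => (hVc t).isClosed)
      (U := Metric.thickening ε (⋂ t, V t)) fun x hx =>
        Metric.isOpen_thickening.mem_nhds (Metric.self_subset_thickening hε _ hx)
    refine ⟨t₂ + t₁, fun t ht x hx => ?_⟩
    have h1 : t₁ ≤ t - t₂ := le_tsub_of_add_le_left ht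
    have h2 : S t x ∈ V t₂ := ⟨S (t - t₂) x, ht₁ _ h1 x hx, by
      rw [hS.add, add_tsub_cancel_of_le (le_self_add.trans ht)]⟩
    exact Metric.mem_thickening_iff.1 (ht₂ h2)

variable {H : Type*} [NormedAddCommGroup H] [InnerProductSpace ℝ H] [CompleteSpace H]
  {P : ℝ → H →L[ℝ] H} {d : ℝ} {r : ℝ≥0} {F : Hist r H → H} {M : ℝ}

theorem IsSol.apply_of_nonneg {hP : DiscreteFamily P} {φ : Hist r H} {u : C(ℝ, H)}
    (hu : IsSol hP d F φ u) {t : ℝ} (ht : 0 ≤ t) :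
    u t = evol hP d t (atZero φ) + duhamel hP d (fun s => F (segment r u s)) t := by
  rw [← hP.freeEvol_of_nonneg φ ht]
  exact hu t

theorem IsSol.segment_zero {hP : DiscreteFamily P} (hd : 0 ≤ d) {φ : Hist r H} {u : C(ℝ, H)}
    (hu : IsSol hP d F φ u) : segment r u 0 = φ := by
  ext θ
  rw [segment_apply, zero_add]
  exact (hu.isSolOn hd 0).1 θ

/-- Time translates of solutions are solutions. -/
theorem IsSol.shift {hP : DiscreteFamily P} (hd : 0 ≤ d) (hF : Continuous F) {φ : Hist r H}
    {u : C(ℝ, H)} (hu : IsSol hP d F φ u) {τ : ℝ} (hτ : 0 ≤ τ) (T : ℝ) :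
    IsSolOn hP d F (segment r u τ) T (u.comp ⟨fun t => t + τ, by fun_prop⟩) := by
  refine ⟨fun θ => congrArg u (add_comm _ _), fun t ht => ?_⟩
  have h0 : atZero (segment r u τ) = u τ := congrArg u (add_zero τ)
  have h1 : ∫ s in (0 : ℝ)..t, evol hP d (t - s) (F (segment r u (s + τ))) =
      ∫ s in τ..τ + t, evol hP d (τ + t - s) (F (segment r u s)) := by
    have h2 := intervalIntegral.integral_comp_add_right (a := 0) (b := t)
      (fun s => evol hP d (τ + t - s) (F (segment r u s))) τ
    rw [zero_add, add_comm t τ] at h2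
    rw [← h2]
    refine intervalIntegral.integral_congr fun s _ => ?_
    congr 2
    ring
  simp only [segment_comp_add]
  rw [h0, h1, hu.apply_of_nonneg hτ, map_add, ← hP.evol_add hd ht.1 hτ, add_assoc,
    ← hP.duhamel_add hd (continuous_comp_segment hF u) hτ ht.1, add_comm t τ]
  change u (t + τ) = _
  rw [add_comm t τ]
  exact hu.apply_of_nonneg (add_nonneg hτ ht.1)

theorem IsSol.norm_le {hP : DiscreteFamily P} (hd : 0 ≤ d) {c : ℝ} (hc0 : 0 < c)
    (hc : ∀ μ, P μ ≠ 0 → c ≤ μ) (hM : ∀ φ, ‖F φ‖ ≤ M) {φ : Hist r H} {u : C(ℝ, H)}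
    (hu : IsSol hP d F φ u) {t : ℝ} (ht : 0 ≤ t) :
    ‖u t‖ ≤ Real.exp (-(c * t)) * ‖φ‖ + M / c := by
  rw [hu.apply_of_nonneg ht]
  refine (norm_add_le _ _).trans (add_le_add ((hP.norm_evol_le_exp hd hc ht _).trans ?_)
    (hP.norm_duhamel_le hd hc0 hc (fun _ => hM _) t))
  gcongr
  exact norm_atZero_le φ

/-- A compact set of histories with values in an energy set. -/
def regularSet (P : ℝ → H →L[ℝ] H) (d M ρ : ℝ) (r : ℝ≥0) : Set (Hist r H) :=
  {g | (∀ θ, g θ ∈ energySet P d (ρ + 2 * √(r + 1) * M)) ∧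
    ∀ θ θ', dist (g θ) (g θ') ≤
      √|(θ : ℝ) - θ'| * ρ + duhamelModulus M (r + 1 + θ) (r + 1 + θ')}

theorem DiscreteFamily.isCompact_regularSet (hP : DiscreteFamily P) (hd : 0 ≤ d) (M ρ : ℝ)
    (r : ℝ≥0) : IsCompact (regularSet P d M ρ r) := by
  refine isCompact_setOf_modulus (fun _ => hP.isCompact_energySet hd) fun θ => ?_
  have h1 : Tendsto (fun θ' : Icc (-(r : ℝ)) 0 => √|(θ : ℝ) - θ'| * ρ) (𝓝 θ) (𝓝 0) := by
    have h : Continuous fun θ' : Icc (-(r : ℝ)) 0 => √|(θ : ℝ) - θ'| * ρ := by fun_prop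
    simpa using h.tendsto θ
  have h2 : Tendsto (fun θ' : Icc (-(r : ℝ)) 0 => (r : ℝ) + 1 + θ') (𝓝 θ)
      (𝓝 ((r : ℝ) + 1 + θ)) :=
    (by fun_prop : Continuous fun θ' : Icc (-(r : ℝ)) 0 => (r : ℝ) + 1 + θ').tendsto θ
  simpa using h1.add ((tendsto_duhamelModulus M _).comp h2)

theorem DiscreteFamily.dist_evol_le (hP : DiscreteFamily P) (hd : 0 ≤ d) {s t : ℝ} (hs : 1 ≤ s)
    (ht : 1 ≤ t) (x : H) : dist (evol hP d s x) (evol hP d t x) ≤ √|s - t| * ‖x‖ := by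
  wlog h : s ≤ t generalizing s t
  · rw [dist_comm, abs_sub_comm]
    exact this ht hs (le_of_not_ge h)
  have h0 : 0 < s := one_pos.trans_le hs
  have h1 : evol hP d t x = evol hP d (t - s) (evol hP d s x) := by
    rw [← hP.evol_add hd (sub_nonneg.2 h) h0.le, sub_add_cancel]
  rw [dist_comm, dist_eq_norm, h1, abs_sub_comm, abs_of_nonneg (sub_nonneg.2 h)]
  refine hP.norm_evol_sub_le hd (norm_nonneg x) ?_ (sub_nonneg.2 h)
  refine energySet_mono ?_ (hP.evol_mem_energySet hd h0 x)
  exact mul_le_of_le_one_left (norm_nonneg x)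
    (Real.rpow_le_one_of_one_le_of_nonpos hs (by norm_num))

theorem IsSol.segment_mem_regularSet {hP : DiscreteFamily P} (hd : 0 ≤ d) (hF : Continuous F)
    (hM : ∀ φ, ‖F φ‖ ≤ M) {φ : Hist r H} {u : C(ℝ, H)} (hu : IsSol hP d F φ u) {ρ : ℝ}
    (hφ : ‖φ‖ ≤ ρ) : segment r u (r + 1) ∈ regularSet P d M ρ r := by
  have hr : (0 : ℝ) ≤ r := r.2
  have hM0 : 0 ≤ M := (norm_nonneg _).trans (hM φ)
  have hx : ‖atZero φ‖ ≤ ρ := (norm_atZero_le φ).trans hφ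
  have hf := continuous_comp_segment hF u
  have h1 : ∀ θ : Icc (-(r : ℝ)) 0, 1 ≤ r + 1 + (θ : ℝ) := fun θ => by linarith [θ.2.1]
  have h2 : ∀ θ : Icc (-(r : ℝ)) 0, segment r u (r + 1) θ =
      evol hP d (r + 1 + θ) (atZero φ) +
        duhamel hP d (fun s => F (segment r u s)) (r + 1 + θ) := fun θ =>
    hu.apply_of_nonneg (zero_le_one.trans (h1 θ))
  refine ⟨fun θ => ?_, fun θ θ' => ?_⟩
  · have h0 : 0 < r + 1 + (θ : ℝ) := one_pos.trans_le (h1 θ)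
    rw [h2]
    refine add_mem_energySet (energySet_mono ?_ (hP.evol_mem_energySet hd h0 _))
      (energySet_mono ?_ (hP.duhamel_mem_energySet hd hf (fun _ => hM _) _))
    · exact (mul_le_of_le_one_left (norm_nonneg _)
        (Real.rpow_le_one_of_one_le_of_nonpos (h1 θ) (by norm_num))).trans hx
    · rw [max_eq_left h0.le]
      have h3 : √(r + 1 + (θ : ℝ)) ≤ √(r + 1) := Real.sqrt_le_sqrt (by linarith [θ.2.2])
      gcongr
  · rw [h2, h2]
    refine (dist_add_add_le _ _ _ _).trans (add_le_add ?_
      (hP.dist_duhamel_le hd hf (fun _ => hM _) _ _))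
    refine (hP.dist_evol_le hd (h1 θ) (h1 θ') _).trans ?_
    rw [add_sub_add_left_eq_sub]
    gcongr

namespace DiscreteFamily

variable (hP : DiscreteFamily P)

/-- The solution operators `S_t φ = u_t`, for any choice `sol` of solutions. -/
theorem isDynamicalSystem (hd : 0 ≤ d) (hF : Continuous F) (hM : ∀ φ, ‖F φ‖ ≤ M)
    (hL : LipschitzAlong F) {sol : Hist r H → C(ℝ, H)} (hsol : ∀ φ, IsSol hP d F φ (sol φ)) :
    IsDynamicalSystem fun (t : ℝ≥0) φ => segment r (sol φ) t where
  zero φ := by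
    rw [NNReal.coe_zero]
    exact (hsol φ).segment_zero hd
  add t τ φ := by
    have h1 := (hsol φ).shift hd hF τ.2 t
    have h2 := (hsol (segment r (sol φ) τ)).isSolOn hd t
    have h3 := hP.eqOn_of_isSolOn hd hF hL h2 h1
    rw [NNReal.coe_add, ← segment_comp_add]
    refine segment_congr fun σ hσ => h3 σ ⟨?_, hσ.2⟩
    linarith [hσ.1, t.2]
  strongly_continuous φ :=
    (continuous_segment_right (sol φ)).comp NNReal.continuous_coe
  continuous t := by
    have h : Continuous sol := continuous_iff_seqContinuous.2 fun φ φ₀ hφ =>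
      hP.tendsto_sol hd hF hM hL hφ (fun n => hsol _) (hsol φ₀)
    exact continuous_segment.comp (h.prodMk continuous_const)

theorem exists_absorbing (hd : 0 ≤ d) (hF : Continuous F) (hM : ∀ φ, ‖F φ‖ ≤ M)
    (hL : LipschitzAlong F) {sol : Hist r H → C(ℝ, H)} (hsol : ∀ φ, IsSol hP d F φ (sol φ)) :
    ∃ ρ, ∀ D : Set (Hist r H), Bornology.IsBounded D → ∃ t₀ : ℝ≥0, ∀ t ≥ t₀, ∀ φ ∈ D,
      segment r (sol φ) t ∈ regularSet P d M ρ r := by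
  obtain ⟨c, hc0, hc⟩ := hP.gap
  refine ⟨1 + M / c, fun D hD => ?_⟩
  obtain ⟨R, hR⟩ := hD.exists_norm_le
  have hlim : Tendsto (fun t : ℝ => Real.exp (-(c * t)) * |R|) atTop (𝓝 0) := by
    have h : Tendsto (fun t : ℝ => Real.exp (-(c * t))) atTop (𝓝 0) :=
      Real.tendsto_exp_neg_atTop_nhds_zero.comp (tendsto_id.const_mul_atTop hc0)
    simpa using h.mul_const |R|
  obtain ⟨t₁, ht₁⟩ := eventually_atTop.1 (hlim.eventually_le_const one_pos)
  refine ⟨t₁.toNNReal + r + (r + 1), fun t ht φ hφ => ?_⟩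
  obtain ⟨s, hs, rfl⟩ : ∃ s : ℝ≥0, t₁.toNNReal + r ≤ s ∧ t = (r + 1) + s := by
    refine ⟨t - (r + 1), le_tsub_of_add_le_right ht, ?_⟩
    rw [add_tsub_cancel_of_le (le_add_self.trans ht)]
  have hdyn := hP.isDynamicalSystem hd hF hM hL hsol
  have h1 : segment r (sol (segment r (sol φ) s)) ((r + 1 : ℝ≥0) : ℝ) =
      segment r (sol φ) ((r + 1 + s : ℝ≥0) : ℝ) := hdyn.add (r + 1) s φ
  rw [← h1]
  rw [NNReal.coe_add, NNReal.coe_one]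
  refine (hsol _).segment_mem_regularSet hd hF hM ?_
  have hM0 : 0 ≤ M := (norm_nonneg _).trans (hM φ)
  refine (ContinuousMap.norm_le _ (by positivity)).2 fun θ => ?_
  have h2 : t₁ + r ≤ s := by
    have h3 : ((t₁.toNNReal + r : ℝ≥0) : ℝ) ≤ s := NNReal.coe_le_coe.2 hs
    rw [NNReal.coe_add] at h3
    linarith [Real.le_coe_toNNReal t₁]
  have h3 : (r : ℝ) ≤ s := by exact_mod_cast le_add_self.trans hs
  have h4 : 0 ≤ (s : ℝ) + θ := by linarith [θ.2.1]
  rw [segment_apply]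
  refine ((hsol φ).norm_le hd hc0 hc hM h4).trans ?_
  gcongr
  refine le_trans ?_ (ht₁ (s + θ) (by linarith [θ.2.1]))
  gcongr
  exact (hR φ hφ).trans (le_abs_self R)

end DiscreteFamily

end

section

variable {H : Type*} [NormedAddCommGroup H] [InnerProductSpace ℝ H] [CompleteSpace H]
  {A : H →ₗ.[ℝ] H} {d C δ : ℝ}

theorem DiscreteFamily.mem_fracPow_domain (hP : DiscreteFamily (specProj A)) (hd : 0 ≤ d)
    (hδ0 : 0 ≤ δ) (hδ : δ < 1 / 2) {x : H} (hx : x ∈ energySet (specProj A) d C) :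
    x ∈ (fracPow A δ).domain := by
  obtain ⟨c, hc, hc'⟩ := hP.gap
  change Summable fun μ : ℝ => μ ^ δ • specProj A μ x
  rw [hP.summable_iff]
  refine summable_of_sum_le (fun _ => by positivity)
    (hP.sum_sq_le_of_mem hd hx (κ := 1 / c + 1) (by positivity) fun μ hμ => ?_)
  have h0 := hP.pos hμ
  have h1 : (μ ^ δ) ^ 2 = μ ^ (2 * δ) := by
    rw [mul_comm, Real.rpow_mul h0.le, Real.rpow_two]
  have h2 : 1 ≤ 1 / c * μ := by
    rw [one_div_mul_eq_div, le_div_iff₀ hc, one_mul]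
    exact hc' μ hμ
  have h3 : μ ^ (2 * δ) ≤ 1 + μ := by
    rcases le_total μ 1 with h | h
    · linarith [Real.rpow_le_one h0.le h (by linarith : 0 ≤ 2 * δ)]
    · have := Real.rpow_le_rpow_of_exponent_le h (by linarith : 2 * δ ≤ 1)
      rw [Real.rpow_one] at this
      linarith
  have h4 : 0 ≤ 1 / c := by positivity
  rw [h1]
  nlinarith

/-- `A^δ` with `δ < 1/2` is controlled by the norm on low energies and by the energy on high
energies. -/
theorem DiscreteFamily.norm_fracPow_sq_le (hP : DiscreteFamily (specProj A)) (hd : 0 ≤ d)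
    (hδ0 : 0 ≤ δ) (hδ : δ < 1 / 2) (z : (fracPow A δ).domain)
    (hz : (z : H) ∈ energySet (specProj A) d C) {N : ℝ} (hN : 0 < N) :
    ‖fracPow A δ z‖ ^ 2 ≤ N ^ (2 * δ) * ‖(z : H)‖ ^ 2 + N ^ (2 * δ - 1) * C ^ 2 := by
  have hs : HasSum (fun μ : ℝ => μ ^ δ • specProj A μ (z : H)) (fracPow A δ z) := z.2.hasSum
  refine hasSum_le_of_sum_le (hP.hasSum_norm_sq_of_hasSum hs) fun F => ?_
  calc ∑ μ ∈ F, (μ ^ δ) ^ 2 * ‖specProj A μ (z : H)‖ ^ 2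
      ≤ ∑ μ ∈ F, (N ^ (2 * δ) * ‖specProj A μ (z : H)‖ ^ 2 +
          N ^ (2 * δ - 1) * ((μ + d) * ‖specProj A μ (z : H)‖ ^ 2)) := by
        refine Finset.sum_le_sum fun μ _ => ?_
        by_cases h : specProj A μ = 0
        · simp [h]
        have h0 := hP.pos h
        rw [← mul_assoc, ← add_mul]
        gcongr ?_ * _
        rw [← Real.rpow_two, ← Real.rpow_mul h0.le, mul_comm δ 2]
        have hN1 : 0 ≤ N ^ (2 * δ) := Real.rpow_nonneg hN.le _
        have hN2 : 0 ≤ N ^ (2 * δ - 1) := Real.rpow_nonneg hN.le _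
        rcases le_total μ N with hμ | hμ
        · have h1 := Real.rpow_le_rpow h0.le hμ (by linarith : 0 ≤ 2 * δ)
          have h2 : 0 ≤ N ^ (2 * δ - 1) * (μ + d) := by positivity
          linarith
        · have h1 : μ ^ (2 * δ) = μ ^ (2 * δ - 1) * μ := by
            rw [← Real.rpow_add_one h0.ne']
            congr 1
            ring
          have h2 : μ ^ (2 * δ - 1) ≤ N ^ (2 * δ - 1) :=
            Real.rpow_le_rpow_of_nonpos hN hμ (by linarith)
          have h3 : μ ^ (2 * δ - 1) * μ ≤ N ^ (2 * δ - 1) * (μ + d) := by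
            gcongr
            linarith
          linarith
    _ = N ^ (2 * δ) * ∑ μ ∈ F, ‖specProj A μ (z : H)‖ ^ 2 +
          N ^ (2 * δ - 1) * ∑ μ ∈ F, (μ + d) * ‖specProj A μ (z : H)‖ ^ 2 := by
        rw [Finset.sum_add_distrib, Finset.mul_sum, Finset.mul_sum]
    _ ≤ _ := by
        gcongr
        · exact hP.sum_norm_sq_le F _
        · exact hP.sum_le_of_mem hd hz F

/-- `A^δ` is continuous on energy sets, as a map into its graph. -/
theorem DiscreteFamily.exists_continuous_graph (hP : DiscreteFamily (specProj A)) (hd : 0 ≤ d)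
    (hδ0 : 0 ≤ δ) (hδ : δ < 1 / 2) :
    ∃ j : C(energySet (specProj A) d C, (fracPow A δ).graph),
      ∀ x, ((j x : (fracPow A δ).graph) : H × H).1 = x := by
  have hmem : ∀ x : energySet (specProj A) d C, (x : H) ∈ (fracPow A δ).domain := fun x =>
    hP.mem_fracPow_domain hd hδ0 hδ x.2
  have hcont : Continuous fun x : energySet (specProj A) d C => fracPow A δ ⟨x, hmem x⟩ := by
    rw [Metric.continuous_iff]
    intro y ε hε
    have hlim : Tendsto (fun N : ℝ => N ^ (2 * δ - 1) * (C + C) ^ 2) atTop (𝓝 0) := by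
      have h := (tendsto_rpow_neg_atTop (by linarith : 0 < 1 - 2 * δ)).mul_const ((C + C) ^ 2)
      simpa using h
    obtain ⟨N, hN0, hN⟩ := ((eventually_gt_atTop 0).and
      (hlim.eventually_lt_const (by positivity : 0 < ε ^ 2 / 2))).exists
    have hN1 : 0 < N ^ (2 * δ) := Real.rpow_pos_of_pos hN0 _
    refine ⟨√(ε ^ 2 / 2 / N ^ (2 * δ)), by positivity, fun x hx => ?_⟩
    rw [Subtype.dist_eq, dist_eq_norm] at hx
    let a : (fracPow A δ).domain := ⟨x, hmem x⟩
    let b : (fracPow A δ).domain := ⟨y, hmem y⟩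
    have hab : ((a - b : (fracPow A δ).domain) : H) = (x : H) - y := rfl
    have h1 := hP.norm_fracPow_sq_le (C := C + C) hd hδ0 hδ (a - b)
      (by rw [hab]; exact sub_mem_energySet x.2 y.2) hN0
    rw [LinearPMap.map_sub, hab] at h1
    have h2 : ‖(x : H) - y‖ ^ 2 ≤ ε ^ 2 / 2 / N ^ (2 * δ) := by
      have h3 := pow_le_pow_left₀ (norm_nonneg _) hx.le 2
      rwa [Real.sq_sqrt (by positivity)] at h3
    rw [le_div_iff₀ hN1] at h2
    rw [dist_eq_norm]
    refine lt_of_pow_lt_pow_left₀ 2 hε.le (h1.trans_lt ?_)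
    linarith
  exact ⟨⟨fun x => ⟨(x, fracPow A δ ⟨x, hmem x⟩),
      LinearPMap.mem_graph (fracPow A δ) ⟨(x : H), hmem x⟩⟩,
    (continuous_subtype_val.prodMk hcont).subtype_mk _⟩, fun _ => rfl⟩

theorem inclPow_injective {r : ℝ≥0} : Function.Injective (inclPow (r := r) A δ) := by
  intro φ ψ h
  ext θ : 1
  have h1 : (φ θ : H × H).1 = (ψ θ : H × H).1 := DFunLike.congr_fun h θ
  exact Subtype.ext (Prod.ext h1
    (LinearPMap.mem_graph_snd_inj (fracPow A δ) (φ θ).2 (ψ θ).2 h1))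

/-- Compact sets of histories with values in an energy set are compact in `C([-r, 0]; D(A^δ))`. -/
theorem DiscreteFamily.isCompact_preimage_inclPow {r : ℝ≥0} (hP : DiscreteFamily (specProj A))
    (hd : 0 ≤ d) (hδ0 : 0 ≤ δ) (hδ : δ < 1 / 2) {𝒜 : Set (Hist r H)} (hc : IsCompact 𝒜)
    (h𝒜 : ∀ φ ∈ 𝒜, ∀ θ, φ θ ∈ energySet (specProj A) d C) :
    𝒜 ⊆ range (inclPow (r := r) A δ) ∧ IsCompact (inclPow (r := r) A δ ⁻¹' 𝒜) := by
  obtain ⟨j, hj⟩ := hP.exists_continuous_graph (C := C) hd hδ0 hδ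
  let i : C(energySet (specProj A) d C, H) := ⟨Subtype.val, continuous_subtype_val⟩
  let I : C(Icc (-(r : ℝ)) 0, energySet (specProj A) d C) → Hist r H := fun g => i.comp g
  let J : C(Icc (-(r : ℝ)) 0, energySet (specProj A) d C) → HistPow r A δ := fun g => j.comp g
  have hIJ : ∀ g, inclPow A δ (J g) = I g := fun g => by
    ext θ : 1
    exact hj (g θ)
  have hrange : 𝒜 ⊆ range I := fun φ hφ =>
    ⟨⟨fun θ => ⟨φ θ, h𝒜 φ hφ θ⟩, φ.continuous.subtype_mk _⟩, rfl⟩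
  have hind : IsInducing I := i.isInducing_postcomp IsInducing.subtypeVal
  have hpre : IsCompact (I ⁻¹' 𝒜) := (hind.isCompact_preimage_iff hrange).2 hc
  have himage : inclPow A δ ⁻¹' 𝒜 = J '' (I ⁻¹' 𝒜) := by
    ext ψ
    constructor
    · intro hψ
      obtain ⟨g, hg⟩ := hrange hψ
      exact ⟨g, by rwa [mem_preimage, hg], inclPow_injective ((hIJ g).trans hg)⟩
    · rintro ⟨g, hg, rfl⟩
      rwa [mem_preimage, hIJ]
  refine ⟨fun φ hφ => ?_, himage ▸ hpre.image j.continuous_postcomp⟩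
  obtain ⟨g, hg⟩ := hrange hφ
  exact ⟨J g, (hIJ g).trans hg⟩

theorem discreteFamily_specProj (hA : Dense (A.domain : Set H)) (hsa : IsSelfAdjoint A)
    (hpos : IsPositiveOp A) (hres : HasCompactResolvent A) : DiscreteFamily (specProj A) := by
  obtain ⟨μ₀, R, hc, h1, h2⟩ := hres
  have hR : IsResolventAt A μ₀ R := ⟨h1, h2⟩
  have hP := hR.spectralFamily hc hA hsa
  have hK := hR.exists_isCompact hc hA hsa hpos
  exact
    { toSpectralFamily := hP
      gap := hP.exists_pos_lower_bound (fun μ => hR.pos_of_specProj_ne_zero hpos) hK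
      compact := hK }

theorem DiscreteFamily.semigroup_eq (hP : DiscreteFamily (specProj A)) {t : ℝ} (ht : 0 ≤ t)
    (x : H) : semigroup A t x = evol hP 0 t x := by
  rw [← (hP.hasSum_evol le_rfl t x).tsum_eq]
  simp only [semigroup, add_zero, max_eq_left ht]

variable {r : ℝ≥0} {B : H → H} {η : Hist r H → Icc (0 : ℝ) r}

theorem DiscreteFamily.isMildSolution_iff (hP : DiscreteFamily (specProj A)) (hd : 0 ≤ d)
    (hF : Continuous (delayTerm B η)) {φ : Hist r H} {T : ℝ≥0}
    {u : C(Icc (-(r : ℝ)) (T : ℝ), H)} :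
    IsMildSolution A d B η φ T u ↔ IsSolOn hP d (delayTerm B η) φ T (ext u) := by
  refine and_congr_right fun _ => ?_
  rw [← hP.mild_iff hd (ext u).continuous (continuous_comp_segment hF (ext u))]
  refine forall₂_congr fun t ht => ?_
  rw [hP.semigroup_eq ht.1]
  have h : ∫ s in (0 : ℝ)..t, semigroup A (t - s)
      (delayTerm B η (segment r (ext u) s) - d • ext u s) =
      ∫ s in (0 : ℝ)..t, evol hP 0 (t - s)
        (delayTerm B η (segment r (ext u) s) - d • ext u s) := by
    refine intervalIntegral.integral_congr fun s hs => ?_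
    rw [uIcc_of_le ht.1] at hs
    exact hP.semigroup_eq (sub_nonneg.2 hs.2) _
  rw [h]
  rfl

theorem IsSolOn.congr {hP : DiscreteFamily (specProj A)} {F : Hist r H → H} {φ : Hist r H}
    {T : ℝ} (hT : 0 ≤ T) {u v : C(ℝ, H)} (hu : IsSolOn hP d F φ T u)
    (h : ∀ t ∈ Icc (-(r : ℝ)) T, v t = u t) : IsSolOn hP d F φ T v := by
  have hr : (0 : ℝ) ≤ r := r.2
  refine ⟨fun θ => (h θ ⟨θ.2.1, θ.2.2.trans hT⟩).trans (hu.1 θ), fun t ht => ?_⟩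
  rw [h t ⟨by linarith [ht.1], ht.2⟩, hu.2 t ht]
  congr 1
  refine intervalIntegral.integral_congr fun s hs => ?_
  rw [uIcc_of_le ht.1] at hs
  have h1 : segment r u s = segment r v s := segment_congr fun σ hσ =>
    (h σ ⟨by linarith [hσ.1, hs.1], hσ.2.trans (hs.2.trans ht.2)⟩).symm
  simp only [h1]

/-- Well-posedness of the delay equation and existence of a regular compact global attractor, for
an abstract positive operator with compact resolvent. -/
theorem exists_attractor_of_isSelfAdjoint (hA : Dense (A.domain : Set H)) (hsa : IsSelfAdjoint A)
    (hpos : IsPositiveOp A) (hres : HasCompactResolvent A) (hd : 0 ≤ d) {LB : ℝ≥0}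
    (hB : LipschitzWith LB B) {M : ℝ} (hM : ∀ v, ‖B v‖ ≤ M) {Θu Θl : Hist r H → Icc (0 : ℝ) r}
    (hη : Continuous η) (hΘl : Continuous Θl) (hH : IgnoresOutside η Θu Θl)
    (hcase : (∀ φ, 0 < (Θl φ : ℝ)) ∨ ZeroSetConditions η Θl) :
    (∀ (φ : Hist r H) (T : ℝ≥0), ∃! u : C(Icc (-(r : ℝ)) (T : ℝ), H),
      IsMildSolution A d B η φ T u) ∧
    ∃ S : ℝ≥0 → Hist r H → Hist r H,
      (∀ (φ : Hist r H) (T : ℝ≥0) (u : C(Icc (-(r : ℝ)) (T : ℝ), H)),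
        IsMildSolution A d B η φ T u → ∀ t ≤ T, S t φ = segment r (ext u) t) ∧
      IsDynamicalSystem S ∧
      ∃ 𝒜 : Set (Hist r H), IsCompactGlobalAttractor S 𝒜 ∧
        ∀ δ : ℝ, 0 ≤ δ → δ < 1 / 2 →
          𝒜 ⊆ range (inclPow (r := r) A δ) ∧ IsCompact (inclPow (r := r) A δ ⁻¹' 𝒜) := by
  have hP := discreteFamily_specProj hA hsa hpos hres
  have hF : Continuous (delayTerm B η) := continuous_delayTerm hB.continuous hη
  have hFM : ∀ φ, ‖delayTerm B η φ‖ ≤ M := fun φ => hM _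
  have hL : LipschitzAlong (delayTerm B η) := lipschitzAlong_delayTerm hB hη hΘl hH hcase
  choose sol hsol using hP.exists_isSol hd hF hFM
  have hdyn := hP.isDynamicalSystem hd hF hFM hL hsol
  obtain ⟨ρ, habs⟩ := hP.exists_absorbing hd hF hFM hL hsol
  have hKc := hP.isCompact_regularSet hd M ρ r
  refine ⟨fun φ T => ?_, fun t φ => segment r (sol φ) t, ?_, hdyn, ?_⟩
  · let u : C(Icc (-(r : ℝ)) (T : ℝ), H) := (sol φ).restrict _
    refine ⟨u, ?_, fun v hv => ?_⟩
    · exact (hP.isMildSolution_iff hd hF).2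
        (((hsol φ).isSolOn hd T).congr T.2 fun t ht => ext_apply u ht)
    · ext t : 1
      rw [← ext_apply v t.2]
      exact hP.eqOn_of_isSolOn hd hF hL ((hP.isMildSolution_iff hd hF).1 hv)
        ((hsol φ).isSolOn hd T) t t.2
  · intro φ T u hu t ht
    refine segment_congr fun σ hσ => ?_
    refine hP.eqOn_of_isSolOn hd hF hL ((hsol φ).isSolOn hd T)
      ((hP.isMildSolution_iff hd hF).1 hu) σ ⟨?_, hσ.2.trans (NNReal.coe_le_coe.2 ht)⟩
    linarith [hσ.1, t.2]
  · obtain ⟨𝒜, h𝒜⟩ := hdyn.exists_isCompactGlobalAttractor hKc habs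
    refine ⟨𝒜, h𝒜, fun δ hδ0 hδ => hP.isCompact_preimage_inclPow
      (C := ρ + 2 * √(r + 1) * M) hd hδ0 hδ h𝒜.compact ?_⟩
    obtain ⟨t₀, ht₀⟩ := habs 𝒜 h𝒜.compact.isBounded
    intro φ hφ
    rw [← h𝒜.invariant t₀] at hφ
    obtain ⟨ψ, hψ, rfl⟩ := hφ
    exact (ht₀ t₀ le_rfl ψ hψ).1

end

end DelayParabolic

open DelayParabolic in
theorem theorem3 {n : ℕ} (Ω : Set (EuclideanSpace ℝ (Fin n)))
    (hΩ_open : IsOpen Ω) (hΩ_conn : IsConnected Ω) (hΩ_bdd : Bornology.IsBounded Ω)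
    (r : ℝ≥0) (hr : 0 < r)
    -- the operator `A` in `L²(Ω)` and the constant `d`
    (A : Lp ℝ 2 (volume.restrict Ω) →ₗ.[ℝ] Lp ℝ 2 (volume.restrict Ω))
    (hA_dense : Dense (A.domain : Set (Lp ℝ 2 (volume.restrict Ω))))
    (hA_sa : IsSelfAdjoint A) (hA_pos : IsPositiveOp A) (hA_res : HasCompactResolvent A)
    (d : ℝ) (hd : 0 ≤ d)
    -- the mapping `B`, Lipschitz and bounded
    (B : Lp ℝ 2 (volume.restrict Ω) → Lp ℝ 2 (volume.restrict Ω))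
    (hB_lip : ∃ LB : ℝ≥0, LipschitzWith LB B)
    (hB_bdd : ∃ M : ℝ, ∀ v, ‖B v‖ ≤ M)
    -- the delay `η` and the functions `Θᵘ`, `Θˡ`
    (η Θu Θl : Hist r (Lp ℝ 2 (volume.restrict Ω)) → Icc (0 : ℝ) r)
    (hη : Continuous η) (hΘu : Continuous Θu) (hΘl : Continuous Θl)
    (hΘ : ∀ φ, Θl φ ≤ Θu φ)
    (hH : IgnoresOutside η Θu Θl)
    (hcase : (∀ φ, 0 < (Θl φ : ℝ)) ∨ ZeroSetConditions η Θl) :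
    -- there is a unique mild solution for every initial function and every time horizon
    (∀ (φ : Hist r (Lp ℝ 2 (volume.restrict Ω))) (T : ℝ≥0),
      ∃! u : C(Icc (-(r : ℝ)) (T : ℝ), Lp ℝ 2 (volume.restrict Ω)),
        IsMildSolution A d B η φ T u) ∧
    -- the evolution operator `S_t φ = u_t`
    ∃ S : ℝ≥0 → Hist r (Lp ℝ 2 (volume.restrict Ω)) → Hist r (Lp ℝ 2 (volume.restrict Ω)),
      (∀ (φ : Hist r (Lp ℝ 2 (volume.restrict Ω))) (T : ℝ≥0)
        (u : C(Icc (-(r : ℝ)) (T : ℝ), Lp ℝ 2 (volume.restrict Ω))),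
        IsMildSolution A d B η φ T u → ∀ t ≤ T, S t φ = segment r (ext u) t) ∧
      IsDynamicalSystem S ∧
      -- the compact global attractor
      ∃ 𝒜 : Set (Hist r (Lp ℝ 2 (volume.restrict Ω))),
        IsCompactGlobalAttractor S 𝒜 ∧
        ∀ δ : ℝ, 0 ≤ δ → δ < 1 / 2 →
          𝒜 ⊆ range (inclPow (r := r) A δ) ∧ IsCompact (inclPow (r := r) A δ ⁻¹' 𝒜) := by
  obtain ⟨LB, hLB⟩ := hB_lip
  obtain ⟨M, hM⟩ := hB_bdd
  exact exists_attractor_of_isSelfAdjoint hA_dense hA_sa hA_pos hA_res hd hLB hM hη hΘl hH hcase
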